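/- Let $k$ be a unital commutative ring and let $A$ be a unital associative involutive $k$-algebra, i.e. a $k$-algebra with a $k$-linear map $a\mapsto\overline a$ satisfying $\overline{\overline a}=a$ and $\overline{ab}=\overline b\,\overline a$. Let $\Delta H$ be the category associated to the hyperoctahedral crossed simplicial group: its objects are the sets $[n]=\{0,\dots,n\}$, $n\ge 0$, and a morphism $[n]\to[m]$ is a pair $(\varphi,g)$ with $\varphi\colon[n]\to[m]$ order-preserving and $g=(z_0,\dots,z_n;\sigma)\in H_{n+1}=C_2^{n+1}\rtimes\Sigma_{n+1}$. Let $\mathsf H_A\colon\Delta H\to\mathbf{Mod}_k$ be the hyperoctahedral bar construction, $\mathsf H_A([n])=A^{\otimes(n+1)}$, where $(\varphi,g)$ sends $a_0\otimes\cdots\otimes a_n$ to the tensor whose $j$-th factor is the product of the $a_i^{z_i}$ over $i\in(\varphi\circ\sigma)^{-1}(j)$, ordered by $\sigma(i)$; here $a^{1}=a$, $a^{t}=\overline a$ for the generator $t$ of $C_2$, and an empty product is $1_A$. Let $k^{\star}$ be the constant functor $\Delta H^{op}\to\mathbf{Mod}_k$ with value $k$, and let $HO_n(A)=\mathrm{Tor}_n^{\Delta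 H}(k^{\star},\mathsf H_A)$ be the $n$-th hyperoctahedral homology of $A$, where $\mathrm{Tor}_\star^{\Delta H}$ denotes the left derived functors of the tensor product of functors $-\otimes_{\Delta H}-$. 1. If $A$ is commutative and the involution is trivial, then $HO_0(A)\cong A$ as $k$-modules. 2. If $A$ is commutative and the involution is non-trivial, then $HO_0(A)$ is isomorphic, as a $k$-module, to the coinvariants of the algebra $A$ under the involution, i.e. to the largest quotient algebra of $A$ on which the involution acts trivially, $A/(a-\overline a : a\in A)$, the quotient by the ideal generated by all elements $a-\overline a$. 3. If the two-sided ideal of $A$ generated by all elements $a_0a_1a_2-a_2\overline{a_1}a_0$ with $a_0,a_1,a_2\in A$ is equal to $A$, then $HO_n(A)=0$ for all $n\ge 0$. -/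

import Mathlib

universe u v w

noncomputable section

namespace HyperHom

section Tor

open CategoryTheory Limits

/-- A category of functors on a small category has enough projectives when the target has enough
projectives and coproducts. -/
instance functorEnoughProjectives {C : Type} [SmallCategory C] {D : Type w} [Category.{v} D]
    [EnoughProjectives D] [HasColimits D] [HasFiniteLimits D] [HasCoproducts.{0} D] :
    EnoughProjectives (C ⥤ D) where
  presentation G := by
    have hP (c : C) : Projective
        ((evaluationLeftAdjoint D c).obj (Projective.over (G.obj c))) :=
      Adjunction.map_projective (evaluationAdjunctionRight D c) _ inferInstance
    let f (c : C) : (evaluationLeftAdjoint D c).obj (Projective.over (G.obj c)) ⟶ G :=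
      ((evaluationAdjunctionRight D c).homEquiv _ _).symm (Projective.π (G.obj c))
    have hf (c : C) : ((evaluationAdjunctionRight D c).unit.app _) ≫ (f c).app c
        = Projective.π (G.obj c) := by
      have := ((evaluationAdjunctionRight D c).homEquiv _ _).apply_symm_apply
        (Projective.π (G.obj c))
      rw [Adjunction.homEquiv_unit] at this
      exact this
    have : Epi (Limits.Sigma.desc f) := by
      rw [NatTrans.epi_iff_epi_app]
      intro c
      have : ((evaluationAdjunctionRight D c).unit.app _ ≫ (Limits.Sigma.ι (fun c => (evaluationLeftAdjoint D c).obj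
            (Projective.over (G.obj c))) c).app c) ≫
          (Limits.Sigma.desc f).app c = Projective.π (G.obj c) := by
        rw [Category.assoc, ← NatTrans.comp_app, Limits.Sigma.ι_desc, hf]
      have h2 : Epi (Projective.π (G.obj c)) := Projective.π_epi _
      rw [← this] at h2
      exact @epi_of_epi _ _ _ _ _ _ _ h2
    have hp : Projective
        (∐ fun c => (evaluationLeftAdjoint D c).obj (Projective.over (G.obj c))) := ⟨by
      intro E X g e he
      refine ⟨Limits.Sigma.desc fun c => Projective.factorThru (Limits.Sigma.ι
        (fun c => (evaluationLeftAdjoint D c).obj (Projective.over (G.obj c))) c ≫ g) e, ?_⟩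
      refine Limits.Sigma.hom_ext _ _ fun c => ?_
      rw [Limits.Sigma.ι_desc_assoc, Projective.factorThru_comp]⟩
    exact ⟨{ p := _, projective := hp, f := Limits.Sigma.desc f, epi := this }⟩

variable (k : Type u) [CommRing k] {C : Type} [SmallCategory C]

variable {k} in
/-- The relations `G(α)(x) ⊗ y - x ⊗ F(α)(y)` defining `G ⊗_C F`. -/
def tensorRel (G : Cᵒᵖ ⥤ ModuleCat.{w} k) (F : C ⥤ ModuleCat.{w} k) :
    Submodule k (DirectSum C fun c => TensorProduct k (G.obj (Opposite.op c)) (F.obj c)) :=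
  open Classical in
  Submodule.span k
    {r | ∃ (c d : C) (α : c ⟶ d) (x : G.obj (Opposite.op d)) (y : F.obj c),
      r = DirectSum.lof k C _ c (G.map α.op x ⊗ₜ y) - DirectSum.lof k C _ d (x ⊗ₜ F.map α y)}

variable {k} in
/-- The tensor product `G ⊗_C F` of a right `C`-module `G` and a left `C`-module `F`. -/
abbrev TensorObj (G : Cᵒᵖ ⥤ ModuleCat.{w} k) (F : C ⥤ ModuleCat.{w} k) : Type w :=
  (DirectSum C fun c => TensorProduct k (G.obj (Opposite.op c)) (F.obj c)) ⧸ tensorRel G F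

variable {k} in
/-- The map `[x ⊗ y] ↦ [Θ_c(x) ⊗ y]` induced by `Θ : G ⟶ G'`. -/
def tensorMap {G G' : Cᵒᵖ ⥤ ModuleCat.{w} k} (Θ : G ⟶ G') (F : C ⥤ ModuleCat.{w} k) :
    TensorObj G F →ₗ[k] TensorObj G' F :=
  Submodule.mapQ _ _
    (DirectSum.lmap fun c => TensorProduct.map (Θ.app (Opposite.op c)).hom LinearMap.id) <| by
    classical
    rw [tensorRel, Submodule.span_le]
    rintro _ ⟨c, d, α, x, y, rfl⟩
    refine Submodule.subset_span ⟨c, d, α, (Θ.app (Opposite.op d)).hom x, y, ?_⟩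
    have := congr($(Θ.naturality α.op).hom x)
    simp at this ⊢
    try rw [this]

variable {k} in
@[simp]
theorem tensorMap_mk [DecidableEq C] {G G' : Cᵒᵖ ⥤ ModuleCat.{w} k} (Θ : G ⟶ G')
    (F : C ⥤ ModuleCat.{w} k) (c : C) (x : G.obj (Opposite.op c)) (y : F.obj c) :
    tensorMap Θ F (Submodule.Quotient.mk (DirectSum.lof k C _ c (x ⊗ₜ y))) =
      Submodule.Quotient.mk (DirectSum.lof k C _ c ((Θ.app (Opposite.op c)).hom x ⊗ₜ y)) := by
  simp [tensorMap]

variable {k} in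
theorem tensorObj_hom_ext [DecidableEq C] {G : Cᵒᵖ ⥤ ModuleCat.{w} k} {F : C ⥤ ModuleCat.{w} k}
    {M : Type*} [AddCommGroup M] [Module k M] {f g : TensorObj G F →ₗ[k] M}
    (h : ∀ (c : C) (x : G.obj (Opposite.op c)) (y : F.obj c),
      f (Submodule.Quotient.mk (DirectSum.lof k C _ c (x ⊗ₜ y))) =
        g (Submodule.Quotient.mk (DirectSum.lof k C _ c (x ⊗ₜ y)))) : f = g := by
  apply Submodule.linearMap_qext
  refine DirectSum.linearMap_ext k fun c => TensorProduct.ext' fun x y => h c x y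

/-- The functor `- ⊗_C F` from right `C`-modules to `k`-modules. -/
def tensorFunctor (F : C ⥤ ModuleCat.{w} k) : (Cᵒᵖ ⥤ ModuleCat.{w} k) ⥤ ModuleCat.{w} k where
  obj G := ModuleCat.of k (TensorObj G F)
  map Θ := ModuleCat.ofHom (tensorMap Θ F)
  map_id G := by
    classical
    apply ModuleCat.hom_ext
    exact tensorObj_hom_ext fun c x y => by simp
  map_comp Θ Ψ := by
    classical
    apply ModuleCat.hom_ext
    exact tensorObj_hom_ext fun c x y => by simp

instance (F : C ⥤ ModuleCat.{w} k) : (tensorFunctor k F).Additive where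
  map_add {G G' Θ Ψ} := by
    classical
    apply ModuleCat.hom_ext
    refine tensorObj_hom_ext fun c x y => ?_
    change tensorMap (Θ + Ψ) F _ = tensorMap Θ F _ + tensorMap Ψ F _
    simp only [tensorMap_mk]
    rw [← Submodule.Quotient.mk_add, ← map_add, ← TensorProduct.add_tmul]
    rfl

variable (C) in
/-- The `k`-constant right `C`-module `k^⋆`. -/
def constRight : Cᵒᵖ ⥤ ModuleCat.{max u v} k :=
  (Functor.const _).obj (ModuleCat.of k (ULift.{v} k))

/-- `Tor_n^C(G, F)`: the left derived functors of `- ⊗_C F`, evaluated at `G`. -/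
def Tor [Small.{w} k] (n : ℕ) (G : Cᵒᵖ ⥤ ModuleCat.{w} k) (F : C ⥤ ModuleCat.{w} k) :
    ModuleCat.{w} k :=
  ((tensorFunctor k F).leftDerived n).obj G

end Tor

section DeltaH

/-- A morphism `(φ, g) : [n] ⟶ [m]` of the hyperoctahedral category: an order-preserving map
`φ : [n] → [m]` and an element `g = (z_0, …, z_n; σ)` of `H_{n+1} = C_2^{n+1} ⋊ Σ_{n+1}`.
The group `C_2 = {1, t}` is encoded by `Bool` with `xor`: `false` is `1` and `true` is `t`. -/
@[ext]
structure DHom (n m : ℕ) where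
  φ : Fin (n + 1) →o Fin (m + 1)
  z : Fin (n + 1) → Bool
  σ : Equiv.Perm (Fin (n + 1))

namespace DHom

variable {n m q r : ℕ}

/-- The identity `(id, (1, …, 1; id))`. -/
def id (n : ℕ) : DHom n n := ⟨OrderHom.id, fun _ => false, Equiv.refl _⟩

/-- For `h = (w; τ) ∈ H_{m+1}` and `φ : [n] → [m]` order-preserving, `h` permutes the blocks
`φ⁻¹(j)` according to `τ` and reverses the block `φ⁻¹(j)` when `w_j = t`. The new position of
`p ∈ [n]` is determined by comparing these keys lexicographically. -/
def key (φ : Fin (n + 1) →o Fin (m + 1)) (w : Fin (m + 1) → Bool)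
    (τ : Equiv.Perm (Fin (m + 1))) (p : Fin (n + 1)) : Fin (m + 1) ×ₗ Fin (n + 1) :=
  toLex (τ (φ p), if w (φ p) then p.rev else p)

/-- The underlying permutation of `φ^*(h)`, sending `p ∈ [n]` to its new position. -/
def pullPerm (φ : Fin (n + 1) →o Fin (m + 1)) (w : Fin (m + 1) → Bool)
    (τ : Equiv.Perm (Fin (m + 1))) : Equiv.Perm (Fin (n + 1)) :=
  (Tuple.sort (key φ w τ)).symm

theorem key_injective (φ : Fin (n + 1) →o Fin (m + 1)) (w : Fin (m + 1) → Bool)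
    (τ : Equiv.Perm (Fin (m + 1))) : Function.Injective (key φ w τ) := by
  intro p p' h
  simp only [key, EmbeddingLike.apply_eq_iff_eq, Prod.mk.injEq] at h
  obtain ⟨h1, h2⟩ := h
  rw [h1] at h2
  split_ifs at h2
  · exact Fin.rev_injective h2
  · exact h2

theorem strictMono_key (φ : Fin (n + 1) →o Fin (m + 1)) (w : Fin (m + 1) → Bool)
    (τ : Equiv.Perm (Fin (m + 1))) : StrictMono (key φ w τ ∘ (pullPerm φ w τ).symm) :=
  (Tuple.monotone_sort _).strictMono_of_injective
    ((key_injective φ w τ).comp (Equiv.injective _))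

/-- The order-preserving map `h_*(φ)`; it satisfies `h_*(φ) ∘ φ^*(h) = τ ∘ φ`. -/
def pushMap (φ : Fin (n + 1) →o Fin (m + 1)) (w : Fin (m + 1) → Bool)
    (τ : Equiv.Perm (Fin (m + 1))) : Fin (n + 1) →o Fin (m + 1) where
  toFun p := τ (φ ((pullPerm φ w τ).symm p))
  monotone' _ _ h := Prod.Lex.monotone_fst _ _ ((strictMono_key φ w τ).monotone h)

theorem pushMap_pullPerm (φ : Fin (n + 1) →o Fin (m + 1)) (w : Fin (m + 1) → Bool)
    (τ : Equiv.Perm (Fin (m + 1))) (p : Fin (n + 1)) :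
    pushMap φ w τ (pullPerm φ w τ p) = τ (φ p) := by
  change τ (φ ((pullPerm φ w τ).symm (pullPerm φ w τ p))) = _
  rw [Equiv.symm_apply_apply]

/-- The composite `(ψ, h) ∘ (φ, g) = (ψ ∘ h_*(φ), φ^*(h) ∘ g)` in the hyperoctahedral category,
where the label of `φ^*(h)` at `p` is the label of `h` at `φ(p)`. -/
def comp (f : DHom n m) (g : DHom m q) : DHom n q where
  φ := g.φ.comp (pushMap f.φ g.z g.σ)
  z i := xor (f.z i) (g.z (f.φ (f.σ i)))
  σ := f.σ.trans (pullPerm f.φ g.z g.σ)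

/-- The `C_2`-labelled ordered set `(φ ∘ σ)⁻¹(j)`, ordered according to `φ`, as a list. -/
def word (f : DHom n m) (j : Fin (m + 1)) : List (Bool × Fin (n + 1)) :=
  ((List.finRange (n + 1)).filter fun p => f.φ p = j).map fun p => (f.z (f.σ.symm p), f.σ.symm p)

/-- The action of `C_2` on labelled ordered sets: `t` reverses the order and all labels. -/
def flip (L : List (Bool × Fin (n + 1))) : Bool → List (Bool × Fin (n + 1))
  | false => L
  | true => (L.map fun x => (!x.1, x.2)).reverse

theorem mem_word {f : DHom n m} {j : Fin (m + 1)} {b : Bool} {i : Fin (n + 1)} :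
    (b, i) ∈ f.word j ↔ f.φ (f.σ i) = j ∧ f.z i = b := by
  simp only [word, List.mem_map, List.mem_filter, List.mem_finRange, true_and, decide_eq_true_eq,
    Prod.mk.injEq]
  constructor
  · rintro ⟨p, rfl, rfl, rfl⟩; simp
  · rintro ⟨rfl, rfl⟩; exact ⟨f.σ i, by simp⟩

theorem mem_flip {L : List (Bool × Fin (n + 1))} {w b : Bool} {i : Fin (n + 1)} :
    (b, i) ∈ flip L w ↔ (xor b w, i) ∈ L := by
  cases w
  · simp [flip]
  · cases b <;> simp [flip]

theorem pairwise_word (f : DHom n m) (j : Fin (m + 1)) :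
    (f.word j).Pairwise fun x y => f.σ x.2 < f.σ y.2 := by
  rw [word, List.pairwise_map]
  simpa using (List.pairwise_lt_finRange _).filter _

theorem eq_of_mem_iff {α β : Type*} [LinearOrder β] {c : α → β} {L L' : List α}
    (h : L.Pairwise fun x y => c x < c y) (h' : L'.Pairwise fun x y => c x < c y)
    (hm : ∀ x, x ∈ L ↔ x ∈ L') : L = L' := by
  have : Std.Irrefl fun x y : α => c x < c y := ⟨fun x => lt_irrefl _⟩
  have : Std.Antisymm fun x y : α => c x < c y := ⟨fun x y hx hy => (hx.asymm hy).elim⟩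
  exact h.eq_of_mem_iff h' hm

theorem word_id (j : Fin (n + 1)) : (id n).word j = [(false, j)] := by
  refine eq_of_mem_iff (pairwise_word _ _) (List.pairwise_singleton _ _) ?_
  rintro ⟨b, i⟩
  rw [mem_word]
  simp [id, and_comm, eq_comm]

theorem word_comp (f : DHom n m) (g : DHom m q) (l : Fin (q + 1)) :
    (f.comp g).word l = (g.word l).flatMap fun x => flip (f.word x.2) x.1 := by
  refine eq_of_mem_iff (c := fun x => key f.φ g.z g.σ (f.σ x.2)) ?_ ?_ ?_
  · refine (pairwise_word _ _).imp fun {x y} h => ?_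
    simpa [comp] using strictMono_key f.φ g.z g.σ h
  · rw [List.pairwise_flatMap]
    constructor
    · rintro ⟨w, j⟩ hj
      rw [mem_word] at hj
      cases w
      · change (f.word j).Pairwise _
        refine List.Pairwise.imp_of_mem ?_ (pairwise_word f j)
        rintro ⟨b, i⟩ ⟨b', i'⟩ hi hi' h
        rw [mem_word] at hi hi'
        simp only [key, hi.1, hi'.1, hj.2, Prod.Lex.toLex_lt_toLex]
        simpa using h
      · simp only [flip]
        rw [List.pairwise_reverse, List.pairwise_map]
        refine List.Pairwise.imp_of_mem ?_ (pairwise_word f j)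
        rintro ⟨b, i⟩ ⟨b', i'⟩ hi hi' h
        rw [mem_word] at hi hi'
        simp only [key, hi.1, hi'.1, hj.2, Prod.Lex.toLex_lt_toLex]
        simpa using h
    · refine (pairwise_word g l).imp ?_
      rintro ⟨w, j⟩ ⟨w', j'⟩ h ⟨b, i⟩ hi ⟨b', i'⟩ hi'
      rw [mem_flip, mem_word] at hi hi'
      simp only [key, hi.1, hi'.1, Prod.Lex.toLex_lt_toLex]
      exact Or.inl h
  · rintro ⟨b, i⟩
    simp only [mem_word, List.mem_flatMap, Prod.exists, mem_flip]
    simp only [comp, OrderHom.comp_coe, Function.comp_apply, Equiv.trans_apply, pushMap_pullPerm]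
    constructor
    · rintro ⟨h, rfl⟩
      refine ⟨g.z (f.φ (f.σ i)), f.φ (f.σ i), ⟨h, rfl⟩, rfl, ?_⟩
      cases f.z i <;> cases g.z (f.φ (f.σ i)) <;> rfl
    · rintro ⟨w, j, ⟨h, rfl⟩, rfl, h'⟩
      refine ⟨h, ?_⟩
      rw [h']
      cases b <;> cases g.z (f.φ (f.σ i)) <;> rfl

theorem flatMap_word (f : DHom n m) :
    (List.finRange (m + 1)).flatMap f.word =
      (List.finRange (n + 1)).map fun p => (f.z (f.σ.symm p), f.σ.symm p) := by
  refine eq_of_mem_iff (c := fun x => f.σ x.2) ?_ ?_ ?_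
  · rw [List.pairwise_flatMap]
    refine ⟨fun j _ => pairwise_word f j, (List.pairwise_lt_finRange _).imp ?_⟩
    rintro j j' h ⟨b, i⟩ hi ⟨b', i'⟩ hi'
    rw [mem_word] at hi hi'
    rw [← hi.1, ← hi'.1] at h
    exact f.φ.monotone.reflect_lt h
  · rw [List.pairwise_map]
    simpa using List.pairwise_lt_finRange _
  · rintro ⟨b, i⟩
    simp only [List.mem_flatMap, mem_word, List.mem_finRange, true_and, List.mem_map,
      Prod.mk.injEq]
    constructor
    · rintro ⟨j, rfl, rfl⟩; exact ⟨f.σ i, by simp⟩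
    · rintro ⟨p, rfl, rfl⟩; simp

theorem word_injective : Function.Injective (word : DHom n m → _) := by
  intro f g h
  have h1 (i) : f.φ (f.σ i) = g.φ (g.σ i) ∧ f.z i = g.z i := by
    have : (f.z i, i) ∈ g.word (f.φ (f.σ i)) := by rw [← h, mem_word]; simp
    rw [mem_word] at this
    exact ⟨this.1.symm, this.2.symm⟩
  have h2 : f.σ.symm = g.σ.symm := by
    have := flatMap_word f
    rw [h, flatMap_word g] at this
    ext p : 1
    exact (congrArg Prod.snd (List.map_inj_left.1 this p (List.mem_finRange p))).symm
  have h3 : f.σ = g.σ := by rw [← Equiv.symm_symm f.σ, h2, Equiv.symm_symm]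
  ext p
  · have := (h1 (f.σ.symm p)).1
    rw [← h3] at this
    simpa using congrArg Fin.val this
  · exact congrFun (funext fun i => (h1 i).2) p
  · rw [h3]

theorem flip_false (L : List (Bool × Fin (n + 1))) : flip L false = L := rfl

theorem flip_flip (L : List (Bool × Fin (n + 1))) (a b : Bool) :
    flip (flip L a) b = flip L (xor a b) := by
  cases a <;> cases b <;> simp [flip, List.map_reverse, Function.comp_def]

theorem flip_flatMap (L : List (Bool × Fin (m + 1))) (W : Fin (m + 1) → List (Bool × Fin (n + 1)))
    (b : Bool) : flip (L.flatMap fun x => flip (W x.2) x.1) b =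
      (flip L b).flatMap fun x => flip (W x.2) x.1 := by
  cases b
  · rfl
  · induction L with
    | nil => rfl
    | cons x L ih =>
      obtain ⟨c, j⟩ := x
      simp only [flip] at ih
      cases c <;> simp [flip, ih, Function.comp_def]

end DHom

/-- The category `ΔH` associated to the hyperoctahedral crossed simplicial group;
`⟨n⟩` is the object `[n]`. -/
@[ext]
structure DeltaH where
  deg : ℕ

open CategoryTheory in
instance : SmallCategory DeltaH where
  Hom a b := DHom a.deg b.deg
  id a := DHom.id a.deg
  comp f g := DHom.comp f g
  id_comp f := DHom.word_injective <| funext fun j => by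
    rw [DHom.word_comp]
    refine Eq.trans ?_ (List.flatMap_singleton' (f.word j))
    refine congrArg (fun F => List.flatMap F (f.word j)) (funext fun x => ?_)
    obtain ⟨c, i⟩ := x
    cases c <;> simp [DHom.word_id, DHom.flip]
  comp_id f := DHom.word_injective <| funext fun j => by
    rw [DHom.word_comp, DHom.word_id]
    simp [DHom.flip]
  assoc f g h := DHom.word_injective <| funext fun j => by
    simp only [DHom.word_comp, List.flatMap_assoc, DHom.flip_flatMap]

end DeltaH

section BarConstruction

variable (k : Type u) [CommRing k] [StarRing k] [TrivialStar k]
  (A : Type v) [Ring A] [StarRing A] [Algebra k A] [StarModule k A]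

variable {A} in
/-- `a^z`, which is `a` for `z = 1` and the conjugate of `a` for `z = t`. -/
def conj (z : Bool) (a : A) : A := if z then star a else a

variable {A} in
/-- The product of the `a_i^{z_i}` over a `C_2`-labelled ordered set. -/
def wordProd {n : ℕ} (a : Fin (n + 1) → A) (L : List (Bool × Fin (n + 1))) : A :=
  (L.map fun x => conj x.1 (a x.2)).prod

variable {A} in
theorem conj_wordProd {n : ℕ} (a : Fin (n + 1) → A) (L : List (Bool × Fin (n + 1))) (z : Bool) :
    conj z (wordProd a L) = wordProd a (DHom.flip L z) := by
  cases z
  · simp [conj, DHom.flip]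
  · induction L with
    | nil => simp [conj, DHom.flip, wordProd]
    | cons x L ih =>
      obtain ⟨c, i⟩ := x
      simp only [wordProd, conj, DHom.flip] at ih ⊢
      simp at ih
      cases c <;> simp [ih]

variable {A} in
theorem wordProd_comp {n m q : ℕ} (f : DHom n m) (g : DHom m q) (a : Fin (n + 1) → A)
    (l : Fin (q + 1)) :
    wordProd a ((f.comp g).word l) = wordProd (fun j => wordProd a (f.word j)) (g.word l) := by
  rw [DHom.word_comp]
  generalize g.word l = L
  induction L with
  | nil => rfl
  | cons x L ih =>
    simp only [wordProd, List.flatMap_cons, List.map_append, List.prod_append, List.map_cons,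
      List.prod_cons] at ih ⊢
    rw [ih]
    congr 1
    exact (conj_wordProd a _ _).symm

variable {A} in
theorem wordProd_update_of_notMem {n : ℕ} (a : Fin (n + 1) → A) (i : Fin (n + 1)) (x : A)
    (L : List (Bool × Fin (n + 1))) (h : ∀ b, (b, i) ∉ L) :
    wordProd (Function.update a i x) L = wordProd a L := by
  refine congrArg List.prod (List.map_congr_left ?_)
  rintro ⟨b, j⟩ hj
  have : j ≠ i := by rintro rfl; exact h b hj
  simp [this]

variable {A} in
theorem wordProd_update {n m : ℕ} (f : DHom n m) (a : Fin (n + 1) → A) (i : Fin (n + 1)) :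
    ∃ P Q : A, ∀ x : A, (fun j => wordProd (Function.update a i x) (f.word j)) =
      Function.update (fun j => wordProd a (f.word j)) (f.φ (f.σ i)) (P * conj (f.z i) x * Q) := by
  have hm : (f.z i, i) ∈ f.word (f.φ (f.σ i)) := by simp [DHom.mem_word]
  obtain ⟨L₁, L₂, hL⟩ := List.append_of_mem hm
  have hp := DHom.pairwise_word f (f.φ (f.σ i))
  rw [hL, List.pairwise_append, List.pairwise_cons] at hp
  refine ⟨wordProd a L₁, wordProd a L₂, fun x => funext fun j => ?_⟩
  by_cases hj : j = f.φ (f.σ i)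
  · subst hj
    rw [Function.update_self, hL]
    have h₁ : wordProd (Function.update a i x) L₁ = wordProd a L₁ :=
      wordProd_update_of_notMem _ _ _ _ fun b hb =>
        (hp.2.2 _ hb _ List.mem_cons_self).false
    have h₂ : wordProd (Function.update a i x) L₂ = wordProd a L₂ :=
      wordProd_update_of_notMem _ _ _ _ fun b hb => (hp.2.1.1 _ hb).false
    rw [← h₁, ← h₂]
    simp [wordProd, mul_assoc]
  · rw [Function.update_of_ne hj]
    refine wordProd_update_of_notMem _ _ _ _ fun b hb => hj ?_
    exact (DHom.mem_word.1 hb).1.symm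

open scoped TensorProduct in
/-- The map `a_0 ⊗ ⋯ ⊗ a_n ↦ ∏_{i ∈ (φσ)⁻¹(0)} a_i^{z_i} ⊗ ⋯ ⊗ ∏_{i ∈ (φσ)⁻¹(m)} a_i^{z_i}`. -/
def barMap {n m : ℕ} (f : DHom n m) :
    (⨂[k] _ : Fin (n + 1), A) →ₗ[k] (⨂[k] _ : Fin (m + 1), A) :=
  PiTensorProduct.lift <| MultilinearMap.mk'
    (fun a => PiTensorProduct.tprod k fun j => wordProd a (f.word j))
    (fun a i x y => by
      obtain ⟨P, Q, h⟩ := wordProd_update f a i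
      have : P * conj (f.z i) (x + y) * Q =
          P * conj (f.z i) x * Q + P * conj (f.z i) y * Q := by
        cases f.z i <;> simp [conj, mul_add, add_mul]
      simp only [h, this, MultilinearMap.map_update_add])
    (fun a i c x => by
      obtain ⟨P, Q, h⟩ := wordProd_update f a i
      have : P * conj (f.z i) (c • x) * Q = c • (P * conj (f.z i) x * Q) := by
        cases f.z i <;> simp [conj]
      simp only [h, this, MultilinearMap.map_update_smul])

theorem barMap_tprod {n m : ℕ} (f : DHom n m) (a : Fin (n + 1) → A) :
    barMap k A f (PiTensorProduct.tprod k a) =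
      PiTensorProduct.tprod k fun j => wordProd a (f.word j) := by
  simp [barMap]

open CategoryTheory TensorProduct in
/-- The hyperoctahedral bar construction `H_A : ΔH ⥤ Mod_k`, `[n] ↦ A^{⊗ (n + 1)}`. -/
def barConstruction : DeltaH ⥤ ModuleCat.{max u v} k where
  obj X := ModuleCat.of k (⨂[k] _ : Fin (X.deg + 1), A)
  map f := ModuleCat.ofHom (barMap k A f)
  map_id X := by
    apply ModuleCat.hom_ext
    apply PiTensorProduct.ext
    ext a
    change barMap k A (DHom.id X.deg) (PiTensorProduct.tprod k a) = PiTensorProduct.tprod k a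
    rw [barMap_tprod]
    simp [DHom.word_id, wordProd, conj]
  map_comp f g := by
    apply ModuleCat.hom_ext
    apply PiTensorProduct.ext
    ext a
    change barMap k A (DHom.comp f g) (PiTensorProduct.tprod k a) =
      barMap k A g (barMap k A f (PiTensorProduct.tprod k a))
    simp only [barMap_tprod, wordProd_comp]

end BarConstruction

section Homology

variable (k : Type u) [CommRing k] [StarRing k] [TrivialStar k]
  (A : Type v) [Ring A] [StarRing A] [Algebra k A] [StarModule k A]

/-- The hyperoctahedral homology `HO_n(A) = Tor_n^{ΔH}(k^⋆, H_A)`. An involutive `k`-algebra is a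
`k`-algebra `A` with a `k`-linear anti-automorphism `star` with `star (star a) = a`; `k` itself
carries the trivial involution, so that `StarModule k A` says that `star` is `k`-linear. -/
def HO (n : ℕ) : ModuleCat.{max u v} k :=
  Tor k n (constRight.{u, v} k DeltaH) (barConstruction k A)

/-- The two-sided ideal `(a_0 a_1 a_2 - a_2 (star a_1) a_0)`. -/
def hyperIdeal (A : Type v) [Ring A] [StarRing A] : TwoSidedIdeal A :=
  TwoSidedIdeal.span {x | ∃ a₀ a₁ a₂ : A, x = a₀ * a₁ * a₂ - a₂ * star a₁ * a₀}

/-- The coinvariants of the algebra `A` under its involution: the largest quotient algebra of `A`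
on which the involution acts trivially, that is, the quotient by the two-sided ideal generated by
the elements `a - star a`. -/
abbrev Coinvariants (A : Type v) [Ring A] [StarRing A] : Type v :=
  (TwoSidedIdeal.span {x : A | ∃ a : A, x = a - star a}).ringCon.Quotient

end Homology

end HyperHom

end

/-! Vanishing. Prepending a point, `T = [0] ⊔ -`, is an endofunctor of ΔH, and each `a : A` gives a
natural map `v ↦ a ⊗ v` from `H_A` to `T^* H_A` (`consNat`). Since `T^* k^⋆ = k^⋆`, any natural map
`F ⟶ T^* F` acts on `Tor_n(k^⋆, F)`: lift the identity of `k^⋆` to a chain map from a projective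
resolution `P` to `T^* P`, and tensor. The decisive fact, `act_whiskerRight`, is that composing `F ⟶
T^* F` with the map induced by a natural transformation `T ⟶ T'` leaves the action unchanged,
because the coefficients are constant.

Three kinds of transformation then describe the action of `A`. Inserting a point gives `1` the
identity action; the label `t` on the new point makes `a` and `star a` act equally; and merging two
prepended points in either order makes a product act as the composite in either order. So the action
is additive, multiplicative, commutative and blind to the involution, and it kills `a₀a₁a₂ - a₂(star
a₁)a₀` and the ideal these generate. If that ideal is all of `A`, then `1` acts both as the identity
and as zero.

Degree zero. The functor `- ⊗ H_A` is a left adjoint, hence right exact, so `HO_0(A) = k^⋆ ⊗ H_A`.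
Multiplying all factors moves every class to the object `[0]`, so `A` surjects onto it. For
commutative `A`, two labelled morphisms `[1] ⟶ [0]` identify `ba` with `b (star a)`. Conversely,
multiplying the images of the factors in the algebra of coinvariants is well defined on the tensor
product, so nothing more is identified. -/

noncomputable section

namespace HyperHom

/-! ### Morphisms of ΔH that prepend, label and merge points -/

namespace DHom

variable {n m q : ℕ}

/-- The order-preserving map `id_{[0]} ⊔ φ`. -/
def consOrderHom (φ : Fin (n + 1) →o Fin (m + 1)) : Fin (n + 2) →o Fin (m + 2) where
  toFun := Fin.cases 0 fun i => (φ i).succ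
  monotone' i j h := by
    cases i using Fin.cases with
    | zero => simp
    | succ i =>
      cases j using Fin.cases with
      | zero => simp at h
      | succ j => simpa using φ.monotone (Fin.succ_le_succ_iff.1 h)

@[simp]
theorem consOrderHom_zero (φ : Fin (n + 1) →o Fin (m + 1)) : consOrderHom φ 0 = 0 := rfl

@[simp]
theorem consOrderHom_succ (φ : Fin (n + 1) →o Fin (m + 1)) (i : Fin (n + 1)) :
    consOrderHom φ i.succ = (φ i).succ := rfl

/-- The permutation of `Fin (n + 2)` fixing `0` and acting as `σ` on the other elements. -/
def consPerm (σ : Equiv.Perm (Fin (n + 1))) : Equiv.Perm (Fin (n + 2)) where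
  toFun := Fin.cases 0 fun i => (σ i).succ
  invFun := Fin.cases 0 fun i => (σ.symm i).succ
  left_inv i := by cases i using Fin.cases <;> simp
  right_inv i := by cases i using Fin.cases <;> simp

@[simp]
theorem consPerm_zero (σ : Equiv.Perm (Fin (n + 1))) : consPerm σ 0 = 0 := rfl

@[simp]
theorem consPerm_succ (σ : Equiv.Perm (Fin (n + 1))) (i : Fin (n + 1)) :
    consPerm σ i.succ = (σ i).succ := rfl

/-- The order-preserving map sending `0` to `0` and `i + 1` to `i`. -/
def predOrderHom (n : ℕ) : Fin (n + 2) →o Fin (n + 1) where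
  toFun := Fin.cases 0 fun i => i
  monotone' i j h := by
    cases i using Fin.cases with
    | zero => simp
    | succ i =>
      cases j using Fin.cases with
      | zero => simp at h
      | succ j => simpa using h

@[simp]
theorem predOrderHom_zero : predOrderHom n 0 = 0 := rfl

@[simp]
theorem predOrderHom_succ (i : Fin (n + 1)) : predOrderHom n i.succ = i := rfl

/-- The morphism `id_{[0]} ⊔ f`. -/
def shift (f : DHom n m) : DHom (n + 1) (m + 1) :=
  ⟨consOrderHom f.φ, Fin.cases false f.z, consPerm f.σ⟩

/-- The inclusion `[n] ⟶ [0] ⊔ [n]`. -/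
def insert (n : ℕ) : DHom n (n + 1) := ⟨(Fin.succOrderEmb (n + 1)).toOrderHom,
  fun _ => false, Equiv.refl _⟩

/-- The automorphism `t ⊔ id` of `[0] ⊔ [n]`. -/
def twist (n : ℕ) : DHom (n + 1) (n + 1) := ⟨OrderHom.id, Fin.cases true fun _ => false,
  Equiv.refl _⟩

/-- The morphism `[1] ⊔ [n] ⟶ [0] ⊔ [n]` merging the first two elements, whose order is reversed
if `s` is `true`. -/
def merge (n : ℕ) (s : Bool) : DHom (n + 2) (n + 1) :=
  ⟨predOrderHom _, fun _ => false, if s then Equiv.swap 0 1 else Equiv.refl _⟩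

theorem word_shift_zero (f : DHom n m) : f.shift.word 0 = [(false, 0)] := by
  refine eq_of_mem_iff (pairwise_word _ _) (List.pairwise_singleton _ _) ?_
  rintro ⟨b, i⟩
  rw [mem_word]
  cases i using Fin.cases with
  | zero => simp [shift, eq_comm]
  | succ i => simp [shift]

theorem word_shift_succ (f : DHom n m) (j : Fin (m + 1)) :
    f.shift.word j.succ = (f.word j).map fun x => (x.1, x.2.succ) := by
  refine eq_of_mem_iff (pairwise_word _ _) ?_ ?_
  · rw [List.pairwise_map]
    simpa [shift] using pairwise_word f j
  · rintro ⟨b, i⟩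
    rw [mem_word]
    cases i using Fin.cases <;> simp [shift, mem_word, (Fin.succ_ne_zero _).symm]

theorem word_insert_zero : (insert n).word 0 = [] := by
  refine eq_of_mem_iff (pairwise_word _ _) List.Pairwise.nil ?_
  rintro ⟨b, i⟩
  rw [mem_word]
  simp [insert]

theorem word_insert_succ (j : Fin (n + 1)) : (insert n).word j.succ = [(false, j)] := by
  refine eq_of_mem_iff (pairwise_word _ _) (List.pairwise_singleton _ _) ?_
  rintro ⟨b, i⟩
  rw [mem_word]
  simp [insert, and_comm, eq_comm]

theorem word_twist_zero : (twist n).word 0 = [(true, 0)] := by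
  refine eq_of_mem_iff (pairwise_word _ _) (List.pairwise_singleton _ _) ?_
  rintro ⟨b, i⟩
  rw [mem_word]
  cases i using Fin.cases <;> cases b <;> simp [twist]

theorem word_twist_succ (j : Fin (n + 1)) : (twist n).word j.succ = [(false, j.succ)] := by
  refine eq_of_mem_iff (pairwise_word _ _) (List.pairwise_singleton _ _) ?_
  rintro ⟨b, i⟩
  rw [mem_word]
  cases i using Fin.cases <;> cases b <;> simp [twist, eq_comm]

theorem swap_zero_one_succ_succ (i : Fin (n + 1)) :
    Equiv.swap (0 : Fin (n + 3)) 1 i.succ.succ = i.succ.succ :=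
  Equiv.swap_apply_of_ne_of_ne (Fin.succ_ne_zero _)
    fun h => Fin.succ_ne_zero i (Fin.succ_injective _ h)

theorem predOrderHom_one : predOrderHom (n + 1) 1 = 0 := rfl

theorem word_merge_zero (s : Bool) :
    (merge n s).word 0 = if s then [(false, 1), (false, 0)] else [(false, 0), (false, 1)] := by
  have h1 : (Fin.succ 0 : Fin (n + 3)) = 1 := rfl
  refine eq_of_mem_iff (pairwise_word _ _) ?_ ?_
  · cases s <;> simp [merge]
  rintro ⟨b, i⟩
  rw [mem_word]
  cases i using Fin.cases with
  | zero => cases s <;> cases b <;> simp [merge, predOrderHom_one]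
  | succ i =>
    cases i using Fin.cases with
    | zero => cases s <;> cases b <;> simp [merge, predOrderHom_one, h1]
    | succ i =>
      have h2 : ¬ i.succ.succ = (1 : Fin (n + 3)) :=
        fun h => Fin.succ_ne_zero i (Fin.succ_injective _ h)
      cases s <;> cases b <;> simp [merge, swap_zero_one_succ_succ, h2]

theorem word_merge_succ (s : Bool) (j : Fin (n + 1)) :
    (merge n s).word j.succ = [(false, j.succ.succ)] := by
  have h1 : (Fin.succ 0 : Fin (n + 3)) = 1 := rfl
  have h2 : ¬ 1 = (j.succ.succ : Fin (n + 3)) :=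
    fun h => Fin.succ_ne_zero j (Fin.succ_injective _ (h1.trans h)).symm
  refine eq_of_mem_iff (pairwise_word _ _) (List.pairwise_singleton _ _) ?_
  rintro ⟨b, i⟩
  rw [mem_word]
  cases i using Fin.cases with
  | zero => cases s <;> simp [merge, predOrderHom_one, (Fin.succ_ne_zero _).symm]
  | succ i =>
    cases i using Fin.cases with
    | zero => cases s <;> simp [merge, predOrderHom_one, h1, h2, (Fin.succ_ne_zero _).symm]
    | succ i => cases s <;> simp [merge, swap_zero_one_succ_succ, and_comm, eq_comm]

/-- A morphism is determined by its words, so this and the identities that follow become equalities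
of lists, checked separately at the prepended point and at the old points. -/
theorem shift_id (n : ℕ) : shift (id n) = id (n + 1) :=
  word_injective <| funext fun j => by
    cases j using Fin.cases <;> simp [word_shift_zero, word_shift_succ, word_id]

theorem shift_comp (f : DHom n m) (g : DHom m q) : shift (f.comp g) = (shift f).comp (shift g) :=
  word_injective <| funext fun j => by
    cases j using Fin.cases with
    | zero => simp [word_shift_zero, word_comp, flip]
    | succ j =>
      rw [word_shift_succ, word_comp, word_comp, word_shift_succ, List.map_flatMap,
        List.flatMap_map]
      refine congrArg (fun F => List.flatMap F (g.word j)) (funext fun x => ?_)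
      obtain ⟨c, i⟩ := x
      cases c <;> simp [word_shift_succ, flip, List.map_reverse]

theorem comp_insert (f : DHom n m) : f.comp (insert m) = (insert n).comp (shift f) :=
  word_injective <| funext fun j => by
    cases j using Fin.cases with
    | zero => simp [word_comp, word_shift_zero, word_insert_zero, flip]
    | succ j =>
      simp only [word_comp, word_shift_succ, word_insert_succ, List.flatMap_map, flip,
        List.flatMap_singleton]
      refine (List.flatMap_singleton' (f.word j)).symm.trans ?_
      refine congrArg (fun F => List.flatMap F (f.word j)) (funext fun x => ?_)
      obtain ⟨c, i⟩ := x
      cases c <;> simp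

theorem shift_comp_twist (f : DHom n m) : (shift f).comp (twist m) = (twist n).comp (shift f) :=
  word_injective <| funext fun j => by
    cases j using Fin.cases with
    | zero => simp [word_comp, word_shift_zero, word_twist_zero, flip]
    | succ j =>
      simp only [word_comp, word_shift_succ, word_twist_succ, List.flatMap_map, flip,
        List.flatMap_singleton]
      refine (List.map_eq_flatMap).trans ?_
      refine congrArg (fun F => List.flatMap F (f.word j)) (funext fun x => ?_)
      obtain ⟨c, i⟩ := x
      cases c <;> simp

theorem shift_shift_comp_merge (f : DHom n m) (s : Bool) :
    (shift (shift f)).comp (merge m s) = (merge n s).comp (shift f) :=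
  word_injective <| funext fun j => by
    have h1 : f.shift.shift.word 1 = [(false, 1)] := by
      have := word_shift_succ f.shift 0
      rw [word_shift_zero] at this
      exact this
    cases j using Fin.cases with
    | zero => cases s <;> simp [word_comp, word_shift_zero, word_merge_zero, flip, h1]
    | succ j =>
      simp only [word_comp, word_shift_succ, word_merge_succ, List.flatMap_map, flip,
        List.flatMap_singleton, List.map_map]
      refine (List.map_eq_flatMap).trans ?_
      refine congrArg (fun F => List.flatMap F (f.word j)) (funext fun x => ?_)
      obtain ⟨c, i⟩ := x
      cases c <;> simp

end DHom

/-! ### The endofunctor `[0] ⊔ -` and its natural transformations -/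

open CategoryTheory

/-- The functor `[0] ⊔ -` on `ΔH`. -/
def shiftFunctor : DeltaH ⥤ DeltaH where
  obj X := ⟨X.deg + 1⟩
  map f := DHom.shift f
  map_id X := DHom.shift_id X.deg
  map_comp f g := DHom.shift_comp f g

/-- The inclusion `id ⟶ [0] ⊔ -`. -/
def insertNat : 𝟭 DeltaH ⟶ shiftFunctor where
  app X := DHom.insert X.deg
  naturality _ _ f := DHom.comp_insert f

/-- The automorphism `t ⊔ id` of `[0] ⊔ -`. -/
def twistNat : shiftFunctor ⟶ shiftFunctor where
  app X := DHom.twist X.deg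
  naturality _ _ f := DHom.shift_comp_twist f

/-- The two morphisms `[1] ⊔ - ⟶ [0] ⊔ -`. -/
def mergeNat (s : Bool) : shiftFunctor ⋙ shiftFunctor ⟶ shiftFunctor where
  app X := DHom.merge X.deg s
  naturality _ _ f := DHom.shift_shift_comp_merge f s

/-! ### Left tensoring by an element of the algebra -/

section

variable (k : Type u) [CommRing k] [StarRing k] [TrivialStar k]
  (A : Type v) [Ring A] [StarRing A] [Algebra k A] [StarModule k A]

open TensorProduct in
/-- The linear map `v ↦ a ⊗ v`. -/
def consMap (n : ℕ) (a : A) :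
    (⨂[k] _ : Fin (n + 1), A) →ₗ[k] (⨂[k] _ : Fin (n + 2), A) :=
  PiTensorProduct.lift (MultilinearMap.curryLeft (M := fun _ : Fin (n + 2) => A)
    (PiTensorProduct.tprod k) a)

omit [StarRing k] [TrivialStar k] [StarRing A] [StarModule k A] in
variable {A} in
theorem consMap_tprod {n : ℕ} (a : A) (x : Fin (n + 1) → A) :
    consMap k A n a (PiTensorProduct.tprod k x) =
      PiTensorProduct.tprod k (Fin.cons a x : Fin (n + 2) → A) := by
  simp [consMap]

variable {A} in
theorem wordProd_cons_map {n : ℕ} (a : A) (x : Fin (n + 1) → A) (L : List (Bool × Fin (n + 1))) :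
    wordProd (Fin.cons a x : Fin (n + 2) → A) (L.map fun y => (y.1, y.2.succ)) = wordProd x L := by
  simp [wordProd, Function.comp_def]

variable {A} in
/-- The natural transformation `v ↦ a ⊗ v`. -/
def consNat (a : A) : barConstruction k A ⟶ shiftFunctor ⋙ barConstruction k A where
  app X := ModuleCat.ofHom (consMap k A X.deg a)
  naturality X Y f := by
    apply ModuleCat.hom_ext
    apply PiTensorProduct.ext
    ext x
    change consMap k A _ a (barMap k A f (PiTensorProduct.tprod k x)) =
      barMap k A (DHom.shift f) (consMap k A _ a (PiTensorProduct.tprod k x))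
    rw [barMap_tprod, consMap_tprod, consMap_tprod, barMap_tprod]
    congr 1
    ext j
    cases j using Fin.cases with
    | zero => simp [DHom.word_shift_zero, wordProd, conj]
    | succ j => simp [DHom.word_shift_succ, wordProd_cons_map]

variable {A}

theorem consNat_hom_ext {T : DeltaH ⥤ DeltaH} {f g : barConstruction k A ⟶ T ⋙ barConstruction k A}
    (h : ∀ (X : DeltaH) (x : Fin (X.deg + 1) → A),
      (f.app X).hom (PiTensorProduct.tprod k x) = (g.app X).hom (PiTensorProduct.tprod k x)) :
    f = g := by
  ext X : 2
  apply ModuleCat.hom_ext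
  apply PiTensorProduct.ext
  ext x
  exact h X x

theorem consNat_add (a b : A) : consNat k (a + b) = consNat k a + consNat k b := by
  refine consNat_hom_ext k fun X x => ?_
  change consMap k A _ (a + b) _ = consMap k A _ a _ + consMap k A _ b _
  simp [consMap]

/-- The inserted point has empty fibre, and the empty product is `1`. -/
theorem insertNat_barConstruction :
    Functor.whiskerRight insertNat (barConstruction k A) = consNat k (1 : A) := by
  refine consNat_hom_ext (T := shiftFunctor) k fun X x => ?_
  change barMap k A (DHom.insert _) _ = consMap k A _ 1 _
  rw [barMap_tprod, consMap_tprod]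
  congr 1
  ext j
  cases j using Fin.cases <;>
  simp [DHom.word_insert_zero, DHom.word_insert_succ, wordProd, conj]

theorem consNat_twistNat (a : A) :
    consNat k a ≫ Functor.whiskerRight twistNat (barConstruction k A) = consNat k (star a) := by
  refine consNat_hom_ext k fun X x => ?_
  rw [NatTrans.comp_app, ModuleCat.hom_comp]
  change barMap k A (DHom.twist X.deg) (consMap k A X.deg a (PiTensorProduct.tprod k x)) =
    consMap k A X.deg (star a) (PiTensorProduct.tprod k x)
  rw [consMap_tprod, barMap_tprod, consMap_tprod]
  congr 1
  ext j
  cases j using Fin.cases <;>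
  simp [DHom.word_twist_zero, DHom.word_twist_succ, wordProd, conj]

/-- The element `b` is prepended after `a`, so `b` sits in slot `0` and `a` in slot `1`: merging in
the standard order gives `b * a`, and the swap gives `a * b`. Both products thus arise from the same
map `v ↦ b ⊗ a ⊗ v`. -/
theorem consNat_mergeNat (a b : A) (s : Bool) :
    (consNat k a ≫ Functor.whiskerLeft shiftFunctor (consNat k b)) ≫
      Functor.whiskerRight (mergeNat s) (barConstruction k A) =
        consNat k (if s then a * b else b * a) := by
  refine consNat_hom_ext k fun X x => ?_
  rw [NatTrans.comp_app, ModuleCat.hom_comp, NatTrans.comp_app, ModuleCat.hom_comp]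
  change barMap k A (DHom.merge X.deg s)
    (consMap k A (X.deg + 1) b (consMap k A X.deg a (PiTensorProduct.tprod k x))) =
      consMap k A X.deg (if s then a * b else b * a) (PiTensorProduct.tprod k x)
  rw [consMap_tprod, consMap_tprod, barMap_tprod, consMap_tprod]
  congr 1
  ext j
  have h1 : (Fin.cons b (Fin.cons a x : Fin (X.deg + 2) → A) : Fin (X.deg + 3) → A) 1 = a := rfl
  cases j using Fin.cases with
  | zero => cases s <;> simp [DHom.word_merge_zero, wordProd, conj, h1]
  | succ j => simp [DHom.word_merge_succ, wordProd, conj]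

end

/-! ### Comparison theorem for maps from a projective resolution to an arbitrary one -/

section Lift

open CategoryTheory Limits

variable {D : Type u} [Category.{v} D] [Abelian D] {X : D}

/-- A chain complex `Q` with an augmentation `ε : Q_0 ⟶ X` is a resolution of `X`. -/
structure IsResolution (Q : ChainComplex D ℕ) (ε : Q.X 0 ⟶ X) : Prop where
  w : Q.d 1 0 ≫ ε = 0
  epi : Epi ε
  exact₀ : (ShortComplex.mk _ _ w).Exact
  exact_succ (n : ℕ) : (ShortComplex.mk _ _ (Q.d_comp_d (n + 2) (n + 1) n)).Exact

/-- The augmentation of a projective resolution. -/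
def augmentation (P : ProjectiveResolution X) : P.complex.X 0 ⟶ X := P.π.f 0

theorem isResolution_complex (P : ProjectiveResolution X) :
    IsResolution P.complex (augmentation P) where
  w := P.complex_d_comp_π_f_zero
  epi := inferInstanceAs (Epi (P.π.f 0))
  exact₀ := P.exact₀
  exact_succ := P.exact_succ

variable {Q : ChainComplex D ℕ} {ε : Q.X 0 ⟶ X}

theorem IsResolution.map {E : Type w} [Category.{v} E] [Abelian E] (S : D ⥤ E) [S.Additive]
    [PreservesFiniteLimits S] [PreservesFiniteColimits S] (h : IsResolution Q ε) :
    IsResolution ((S.mapHomologicalComplex _).obj Q) (X := S.obj X) (S.map ε) where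
  w := by
    have := h.w
    change S.map (Q.d 1 0) ≫ S.map ε = 0
    rw [← S.map_comp, this, S.map_zero]
  epi := by
    have := h.epi
    exact inferInstanceAs (Epi (S.map ε))
  exact₀ := h.exact₀.map S
  exact_succ n := (h.exact_succ n).map S

/-- Only the source has to be projective; the target need only be exact. This matters because `Q`
will be `T^* P`, whose terms are not known to be projective. -/
theorem IsResolution.exists_lift (h : IsResolution Q ε) (P : ProjectiveResolution X) :
    ∃ f : P.complex ⟶ Q, f.f 0 ≫ ε = augmentation P := by
  have := h.epi
  let f₀ : P.complex.X 0 ⟶ Q.X 0 := Projective.factorThru (augmentation P) ε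
  have hf₀ : f₀ ≫ ε = augmentation P := Projective.factorThru_comp _ _
  have hw : (P.complex.d 1 0 ≫ f₀) ≫ ε = 0 := by
    rw [Category.assoc, hf₀]
    exact P.complex_d_comp_π_f_zero
  let f₁ : P.complex.X 1 ⟶ Q.X 1 := h.exact₀.liftFromProjective (P.complex.d 1 0 ≫ f₀) hw
  have hf₁ : f₁ ≫ Q.d 1 0 = P.complex.d 1 0 ≫ f₀ := h.exact₀.liftFromProjective_comp _ hw
  refine ⟨ChainComplex.mkHom _ _ f₀ f₁ hf₁ fun n p =>
    ⟨(h.exact_succ n).liftFromProjective (P.complex.d (n + 2) (n + 1) ≫ p.2.1) ?_,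
      (h.exact_succ n).liftFromProjective_comp _ _⟩, ?_⟩
  · simp [p.2.2]
  · simpa using hf₀

theorem IsResolution.homotopy_zero (h : IsResolution Q ε) (P : ProjectiveResolution X)
    (f : P.complex ⟶ Q) (hf : f.f 0 ≫ ε = 0) : Nonempty (Homotopy f 0) := by
  let s₀ : P.complex.X 0 ⟶ Q.X 1 := h.exact₀.liftFromProjective (f.f 0) hf
  have hs₀ : s₀ ≫ Q.d 1 0 = f.f 0 := h.exact₀.liftFromProjective_comp _ hf
  have hw : (f.f 1 - P.complex.d 1 0 ≫ s₀) ≫ Q.d 1 0 = 0 := by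
    rw [Preadditive.sub_comp, Category.assoc, HomologicalComplex.Hom.comm, hs₀, sub_self]
  let s₁ : P.complex.X 1 ⟶ Q.X 2 := (h.exact_succ 0).liftFromProjective _ hw
  have hs₁ : s₁ ≫ Q.d 2 1 = f.f 1 - P.complex.d 1 0 ≫ s₀ :=
    (h.exact_succ 0).liftFromProjective_comp _ hw
  -- At each stage the map minus the part already accounted for is a cycle by the preceding homotopy
  -- identity, so it lifts along the next differential of `Q`.
  refine ⟨Homotopy.mkInductive _ s₀ hs₀.symm s₁ (by rw [hs₁]; abel) fun n p =>
    ⟨(h.exact_succ (n + 1)).liftFromProjective (f.f (n + 2) - P.complex.d _ _ ≫ p.2.1) ?_, ?_⟩⟩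
  · simp [p.2.2]
  · have := (h.exact_succ (n + 1)).liftFromProjective_comp
      (f.f (n + 2) - P.complex.d _ _ ≫ p.2.1) (by simp [p.2.2])
    dsimp at this
    rw [this]
    abel

theorem IsResolution.homotopy (h : IsResolution Q ε) (P : ProjectiveResolution X)
    (f g : P.complex ⟶ Q) (hfg : f.f 0 ≫ ε = g.f 0 ≫ ε) : Nonempty (Homotopy f g) :=
  (h.homotopy_zero P (f - g) (by simp [hfg])).map Homotopy.equivSubZero.symm

end Lift

/-! ### Chain maps induced by a natural transformation `F ⟶ T^* F` -/

section Action

open CategoryTheory Limits TensorProduct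

variable {k : Type u} [CommRing k] {C : Type} [SmallCategory C]

/-- Precomposition of right modules with an endofunctor of `C`. -/
abbrev pull (T : C ⥤ C) : (Cᵒᵖ ⥤ ModuleCat.{w} k) ⥤ (Cᵒᵖ ⥤ ModuleCat.{w} k) :=
  (Functor.whiskeringLeft _ _ _).obj T.op

/-- The natural transformation `T^* ⟶ T'^*` induced by `T' ⟶ T`. -/
abbrev pullMap {T T' : C ⥤ C} (θ : T ⟶ T') : pull (k := k) T' ⟶ pull.{u, w} T :=
  (Functor.whiskeringLeft _ _ _).map (NatTrans.op θ)

variable {F : C ⥤ ModuleCat.{w} k} {T T' : C ⥤ C}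

/-- The map `T^*G ⊗_C F ⟶ G ⊗_C F`, `[x ⊗ y]_c ↦ [x ⊗ ℓ_c(y)]_{T c}`. -/
def pushTensor (ℓ : F ⟶ T ⋙ F) (G : Cᵒᵖ ⥤ ModuleCat.{w} k) :
    TensorObj (T.op ⋙ G) F →ₗ[k] TensorObj G F :=
  open Classical in
  Submodule.liftQ _ (DirectSum.toModule k C _ fun c =>
    (tensorRel G F).mkQ ∘ₗ
      DirectSum.lof k C (fun c => G.obj (Opposite.op c) ⊗[k] F.obj c) (T.obj c) ∘ₗ
        TensorProduct.map LinearMap.id (ℓ.app c).hom) <| by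
    rw [tensorRel, Submodule.span_le]
    rintro _ ⟨c, d, α, x, y, rfl⟩
    have h : (ℓ.app d).hom ((F.map α).hom y) = (F.map (T.map α)).hom ((ℓ.app c).hom y) :=
      congr($(ℓ.naturality α).hom y)
    rw [SetLike.mem_coe, LinearMap.mem_ker, map_sub, sub_eq_zero, DirectSum.toModule_lof,
      DirectSum.toModule_lof]
    simp only [LinearMap.comp_apply, TensorProduct.map_tmul, h]
    exact (Submodule.Quotient.eq _).2 (Submodule.subset_span
      ⟨T.obj c, T.obj d, T.map α, x, (ℓ.app c).hom y, rfl⟩)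

@[simp]
theorem pushTensor_mk [DecidableEq C] (ℓ : F ⟶ T ⋙ F) (G : Cᵒᵖ ⥤ ModuleCat.{w} k) (c : C)
    (x : G.obj (Opposite.op (T.obj c))) (y : F.obj c) :
    pushTensor ℓ G (Submodule.Quotient.mk (DirectSum.lof k C _ c (x ⊗ₜ y))) =
      Submodule.Quotient.mk (DirectSum.lof k C _ (T.obj c) (x ⊗ₜ (ℓ.app c).hom y)) := by
  -- The map was built with the classical instance, while the statement allows any.
  have : ‹DecidableEq C› = Classical.decEq C := Subsingleton.elim _ _
  subst this
  refine (Submodule.liftQ_apply _ _ _).trans ?_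
  rw [DirectSum.toModule_lof]
  rfl

theorem mk_map_tmul [DecidableEq C] (G : Cᵒᵖ ⥤ ModuleCat.{w} k) {c d : C} (α : c ⟶ d)
    (x : G.obj (Opposite.op d)) (y : F.obj c) :
    (Submodule.Quotient.mk (DirectSum.lof k C _ c ((G.map α.op).hom x ⊗ₜ y)) : TensorObj G F) =
      Submodule.Quotient.mk (DirectSum.lof k C _ d (x ⊗ₜ (F.map α).hom y)) := by
  have : ‹DecidableEq C› = Classical.decEq C := Subsingleton.elim _ _
  subst this
  exact (Submodule.Quotient.eq _).2 (Submodule.subset_span ⟨c, d, α, x, y, rfl⟩)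

theorem mk_tmul_add [DecidableEq C] (G : Cᵒᵖ ⥤ ModuleCat.{w} k) (c : C)
    (x : G.obj (Opposite.op c)) (y y' : F.obj c) :
    (Submodule.Quotient.mk (DirectSum.lof k C _ c (x ⊗ₜ (y + y'))) : TensorObj G F) =
      Submodule.Quotient.mk (DirectSum.lof k C _ c (x ⊗ₜ y)) +
        Submodule.Quotient.mk (DirectSum.lof k C _ c (x ⊗ₜ y')) := by
  rw [TensorProduct.tmul_add, map_add, Submodule.Quotient.mk_add]

/-- `pushTensor` as a natural transformation. -/
def pushNat (ℓ : F ⟶ T ⋙ F) : pull T ⋙ tensorFunctor k F ⟶ tensorFunctor k F where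
  app G := ModuleCat.ofHom (pushTensor ℓ G)
  naturality G G' Θ := by
    classical
    apply ModuleCat.hom_ext
    refine tensorObj_hom_ext fun c x y => ?_
    refine (congrArg (pushTensor ℓ G') (tensorMap_mk ((pull T).map Θ) F c x y)).trans ?_
    refine (pushTensor_mk ℓ G' c _ y).trans ?_
    refine Eq.trans ?_ (congrArg (tensorMap Θ F) (pushTensor_mk ℓ G c x y)).symm
    exact (tensorMap_mk Θ F _ _ _).symm

variable (F) in
/-- The functor `- ⊗_C F` on chain complexes. -/
abbrev tensorComplex (K : ChainComplex (Cᵒᵖ ⥤ ModuleCat.{w} k) ℕ) :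
    ChainComplex (ModuleCat.{w} k) ℕ :=
  ((tensorFunctor k F).mapHomologicalComplex _).obj K

variable {K : ChainComplex (Cᵒᵖ ⥤ ModuleCat.{w} k) ℕ}

/-- `pushNat` on chain complexes. -/
def pushComplex (ℓ : F ⟶ T ⋙ F) (K : ChainComplex (Cᵒᵖ ⥤ ModuleCat.{w} k) ℕ) :
    tensorComplex F (((pull T).mapHomologicalComplex _).obj K) ⟶ tensorComplex F K where
  f i := (pushNat ℓ).app (K.X i)
  comm' i j _ := ((pushNat ℓ).naturality (K.d i j)).symm

/-- The endomorphism of `K ⊗_C F` induced by `Θ : K ⟶ T^* K` and `ℓ : F ⟶ T^* F`. -/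
def actComplex (ℓ : F ⟶ T ⋙ F) (Θ : K ⟶ ((pull T).mapHomologicalComplex _).obj K) :
    tensorComplex F K ⟶ tensorComplex F K :=
  ((tensorFunctor k F).mapHomologicalComplex _).map Θ ≫ pushComplex ℓ K

theorem actComplex_apply [DecidableEq C] (ℓ : F ⟶ T ⋙ F)
    (Θ : K ⟶ ((pull T).mapHomologicalComplex _).obj K) (i : ℕ) (c : C)
    (x : (K.X i).obj (Opposite.op c)) (y : F.obj c) :
    ((actComplex ℓ Θ).f i).hom
      (Submodule.Quotient.mk (DirectSum.lof k C _ c (x ⊗ₜ y)) : TensorObj (K.X i) F) =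
      (Submodule.Quotient.mk (DirectSum.lof k C _ (T.obj c)
        (((Θ.f i).app (Opposite.op c)).hom x ⊗ₜ (ℓ.app c).hom y)) : TensorObj (K.X i) F) := by
  refine Eq.trans ?_ (pushTensor_mk ℓ (K.X i) c (((Θ.f i).app (Opposite.op c)).hom x) y)
  exact congrArg (pushTensor ℓ (K.X i)) (tensorMap_mk (Θ.f i) F c x y)

theorem tensorComplex_hom_ext [DecidableEq C] {f g : tensorComplex F K ⟶ tensorComplex F K}
    (h : ∀ (i : ℕ) (c : C) (x : (K.X i).obj (Opposite.op c)) (y : F.obj c),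
      (f.f i).hom (Submodule.Quotient.mk (DirectSum.lof k C _ c (x ⊗ₜ y)) : TensorObj (K.X i) F) =
      (g.f i).hom (Submodule.Quotient.mk (DirectSum.lof k C _ c (x ⊗ₜ y)) : TensorObj (K.X i) F)) :
    f = g := by
  ext i : 1
  apply ModuleCat.hom_ext
  exact tensorObj_hom_ext (h i)

theorem actComplex_add (ℓ ℓ' : F ⟶ T ⋙ F) (Θ : K ⟶ ((pull T).mapHomologicalComplex _).obj K) :
    actComplex (ℓ + ℓ') Θ = actComplex ℓ Θ + actComplex ℓ' Θ := by
  classical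
  refine tensorComplex_hom_ext fun i c x y => ?_
  rw [actComplex_apply]
  refine (mk_tmul_add (K.X i) (T.obj c) _ ((ℓ.app c).hom y) ((ℓ'.app c).hom y)).trans ?_
  exact (congrArg₂ (· + ·) (actComplex_apply ℓ Θ i c x y) (actComplex_apply ℓ' Θ i c x y)).symm

theorem actComplex_id : actComplex (T := 𝟭 C) (𝟙 F) (𝟙 K) = 𝟙 _ := by
  classical
  refine tensorComplex_hom_ext fun i c x y => ?_
  exact actComplex_apply (T := 𝟭 C) (𝟙 F) (𝟙 K) i c x y

theorem actComplex_comp (ℓ : F ⟶ T ⋙ F) (ℓ' : F ⟶ T' ⋙ F)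
    (Θ : K ⟶ ((pull T).mapHomologicalComplex _).obj K)
    (Θ' : K ⟶ ((pull T').mapHomologicalComplex _).obj K) :
    actComplex ℓ Θ ≫ actComplex ℓ' Θ' =
      actComplex (T := T ⋙ T') (ℓ ≫ Functor.whiskerLeft T ℓ')
        (Θ ≫ ((pull T).mapHomologicalComplex _).map Θ') := by
  classical
  refine tensorComplex_hom_ext fun i c x y => ?_
  refine Eq.trans ?_ (actComplex_apply (T := T ⋙ T') _ _ i c x y).symm
  refine Eq.trans (congrArg ((actComplex ℓ' Θ').f i).hom (actComplex_apply ℓ Θ i c x y)) ?_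
  exact actComplex_apply ℓ' Θ' i _ _ _

/-- The relation of the tensor product over `C`, applied to the morphism `θ_c : T c ⟶ T' c`, moves
`θ` from the left factor to the right one. -/
theorem actComplex_pullMap (θ : T ⟶ T') (ℓ : F ⟶ T ⋙ F)
    (Θ : K ⟶ ((pull T').mapHomologicalComplex _).obj K) :
    actComplex ℓ (Θ ≫ (NatTrans.mapHomologicalComplex (pullMap θ) _).app K) =
      actComplex (ℓ ≫ Functor.whiskerRight θ F) Θ := by
  classical
  refine tensorComplex_hom_ext fun i c x y => ?_
  refine Eq.trans (actComplex_apply _ _ i c x y) ?_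
  refine Eq.trans ?_ (actComplex_apply _ _ i c x y).symm
  exact mk_map_tmul (K.X i) (θ.app c) (((Θ.f i).app (Opposite.op c)).hom x) ((ℓ.app c).hom y)

theorem actComplex_homotopy (ℓ : F ⟶ T ⋙ F)
    {Θ Θ' : K ⟶ ((pull T).mapHomologicalComplex _).obj K} (h : Homotopy Θ Θ') (n : ℕ) :
    HomologicalComplex.homologyMap (actComplex ℓ Θ) n =
      HomologicalComplex.homologyMap (actComplex ℓ Θ') n :=
  (((tensorFunctor k F).mapHomotopy h).compRight (pushComplex ℓ K)).homologyMap_eq n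

end Action

/-! ### The action on Tor with constant coefficients -/

section ConstantCoefficients

open CategoryTheory Limits

variable {k : Type u} [CommRing k] {C : Type} [SmallCategory C]
  {P : ProjectiveResolution (constRight.{u, v} k C)} {F : C ⥤ ModuleCat.{max u v} k}
  {T T' : C ⥤ C}

/-- A chain map `P ⟶ T^* P` lifting the identity of `k^⋆ = T^* k^⋆`. -/
def IsLift (Θ : P.complex ⟶ ((pull T).mapHomologicalComplex _).obj P.complex) : Prop :=
  Θ.f 0 ≫ ((pull T).map (augmentation P) : _ ⟶ constRight.{u, v} k C) = augmentation P

variable (P) in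
theorem isResolution_pull (T : C ⥤ C) :
    IsResolution (X := constRight.{u, v} k C)
      (((pull T).mapHomologicalComplex _).obj P.complex) ((pull T).map (augmentation P)) :=
  (isResolution_complex P).map (pull T)

variable (P) in
theorem exists_isLift (T : C ⥤ C) :
    ∃ Θ : P.complex ⟶ ((pull T).mapHomologicalComplex _).obj P.complex, IsLift Θ :=
  (isResolution_pull P T).exists_lift P

theorem IsLift.id : IsLift (T := 𝟭 C) (𝟙 P.complex) :=
  Category.id_comp (augmentation P)

theorem IsLift.comp {Θ : P.complex ⟶ ((pull T).mapHomologicalComplex _).obj P.complex}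
    {Θ' : P.complex ⟶ ((pull T').mapHomologicalComplex _).obj P.complex} (h : IsLift Θ)
    (h' : IsLift Θ') :
    IsLift (T := T ⋙ T') (Θ ≫ ((pull T).mapHomologicalComplex _).map Θ') := by
  have h₁ : (pull T).map (Θ'.f 0) ≫
      (pull T).map ((pull T').map (augmentation P) : _ ⟶ constRight.{u, v} k C) =
        (pull T).map (augmentation P) :=
    ((pull T).map_comp _ _).symm.trans (congrArg (pull T).map h')
  refine Eq.trans ?_ h
  refine (Category.assoc _ _ _).trans ?_
  exact congrArg (Θ.f 0 ≫ ·) h₁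

theorem IsLift.pullMap (θ : T ⟶ T')
    {Θ : P.complex ⟶ ((pull T').mapHomologicalComplex _).obj P.complex} (h : IsLift Θ) :
    IsLift (Θ ≫ (NatTrans.mapHomologicalComplex (pullMap θ) _).app P.complex) := by
  refine Eq.trans ?_ h
  refine (Category.assoc _ _ _).trans ?_
  refine congrArg (Θ.f 0 ≫ ·) ?_
  ext c : 2
  -- The target of the augmentation is constant, so `θ` acts there as the identity; this is where
  -- constant coefficients are essential.
  exact (augmentation P).naturality (θ.app c.unop).op

variable (P) in
/-- The endomorphism of `Tor_n(k^⋆, F)` induced by a natural transformation `F ⟶ T^* F`, computed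
with the projective resolution `P`. -/
def act (n : ℕ) (ℓ : F ⟶ T ⋙ F) :
    (tensorComplex F P.complex).homology n ⟶ (tensorComplex F P.complex).homology n :=
  HomologicalComplex.homologyMap (actComplex ℓ (exists_isLift P T).choose) n

/-- Two lifts of the same identity are homotopic, so the chosen lift may be replaced by whichever
one suits the computation. -/
theorem act_eq (n : ℕ) (ℓ : F ⟶ T ⋙ F)
    {Θ : P.complex ⟶ ((pull T).mapHomologicalComplex _).obj P.complex} (h : IsLift Θ) :
    act P n ℓ = HomologicalComplex.homologyMap (actComplex ℓ Θ) n := by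
  obtain ⟨H⟩ := (isResolution_pull P T).homotopy P _ Θ
    ((exists_isLift P T).choose_spec.trans h.symm)
  exact actComplex_homotopy ℓ H n

theorem act_add (n : ℕ) (ℓ ℓ' : F ⟶ T ⋙ F) : act P n (ℓ + ℓ') = act P n ℓ + act P n ℓ' := by
  rw [act, actComplex_add, HomologicalComplex.homologyMap_add]
  rfl

theorem act_id (n : ℕ) : act P n (T := 𝟭 C) (𝟙 F) = 𝟙 _ := by
  rw [act_eq (T := 𝟭 C) n _ IsLift.id, actComplex_id, HomologicalComplex.homologyMap_id]

theorem act_comp (n : ℕ) (ℓ : F ⟶ T ⋙ F) (ℓ' : F ⟶ T' ⋙ F) :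
    act P n (T := T ⋙ T') (ℓ ≫ Functor.whiskerLeft T ℓ') = act P n ℓ ≫ act P n ℓ' := by
  obtain ⟨Θ, h⟩ := exists_isLift P T
  obtain ⟨Θ', h'⟩ := exists_isLift P T'
  rw [act_eq (T := T ⋙ T') n _ (h.comp h'), act_eq n ℓ h, act_eq n ℓ' h',
    ← HomologicalComplex.homologyMap_comp, actComplex_comp]

/-- A lift for `T'` composed with `θ` is a lift for `T`, and at chain level `θ` may be placed on
either tensor factor. All relations among the operators of `A` come from this invariance. -/
theorem act_whiskerRight (n : ℕ) (θ : T ⟶ T') (ℓ : F ⟶ T ⋙ F) :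
    act P n (ℓ ≫ Functor.whiskerRight θ F) = act P n ℓ := by
  obtain ⟨Θ, h⟩ := exists_isLift P T'
  rw [act_eq n _ h, act_eq n ℓ (h.pullMap θ), actComplex_pullMap]

end ConstantCoefficients

/-! ### The operators of `A` on `HO_n(A)` and the vanishing criterion -/

section Vanishing

open CategoryTheory Limits

variable {k : Type u} [CommRing k] [StarRing k] [TrivialStar k]
  {A : Type v} [Ring A] [StarRing A] [Algebra k A] [StarModule k A]
  (P : ProjectiveResolution (constRight.{u, v} k DeltaH)) (n : ℕ)

theorem act_consNat_one : act P n (consNat k (1 : A)) = 𝟙 _ := by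
  rw [← insertNat_barConstruction]
  refine Eq.trans ?_ (act_id (F := barConstruction k A) n)
  exact (congrArg (act P n) (Category.id_comp _).symm).trans
    (act_whiskerRight (T := 𝟭 DeltaH) n insertNat (𝟙 (barConstruction k A)))

theorem act_consNat_star (a : A) : act P n (consNat k (star a)) = act P n (consNat k a) := by
  rw [← consNat_twistNat, act_whiskerRight]

theorem act_consNat_merge (a b : A) (s : Bool) : act P n (consNat k (if s then a * b else b * a)) =
    act P n (consNat k a) ≫ act P n (consNat k b) := by
  rw [← consNat_mergeNat, act_whiskerRight (T := shiftFunctor ⋙ shiftFunctor), act_comp]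

theorem act_consNat_mul (a b : A) : act P n (consNat k (a * b)) =
    act P n (consNat k a) ≫ act P n (consNat k b) :=
  act_consNat_merge P n a b true

theorem act_consNat_mul' (a b : A) : act P n (consNat k (a * b)) =
    act P n (consNat k b) ≫ act P n (consNat k a) :=
  act_consNat_merge P n b a false

theorem act_consNat_add (a b : A) : act P n (consNat k (a + b)) =
    act P n (consNat k a) + act P n (consNat k b) := by
  rw [consNat_add, act_add]

theorem act_consNat_zero : act P n (consNat k (0 : A)) = 0 := by
  simpa using act_consNat_add P n (0 : A) 0

theorem act_consNat_neg (a : A) : act P n (consNat k (-a)) = -act P n (consNat k a) := by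
  rw [eq_neg_iff_add_eq_zero, ← act_consNat_add, neg_add_cancel, act_consNat_zero]

theorem act_consNat_eq_zero {a : A} (ha : a ∈ hyperIdeal A) : act P n (consNat k a) = 0 := by
  induction ha using TwoSidedIdeal.span_induction with
  | mem x h =>
    obtain ⟨a₀, a₁, a₂, rfl⟩ := h
    -- The first product is expanded in its own order and the second in the reverse order; after
    -- dropping the star, both are the composite of the operators of `a₀`, `a₁`, `a₂`.
    rw [sub_eq_add_neg, act_consNat_add, act_consNat_neg, act_consNat_mul, act_consNat_mul,
      act_consNat_mul' P n (a₂ * star a₁), act_consNat_mul' P n a₂, act_consNat_star,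
      Category.assoc, add_neg_cancel]
  | zero => exact act_consNat_zero P n
  | add x y _ _ hx hy => rw [act_consNat_add, hx, hy, add_zero]
  | neg x _ hx => rw [act_consNat_neg, hx, neg_zero]
  | left_absorb a x _ hx => rw [act_consNat_mul, hx, comp_zero]
  | right_absorb b x _ hx => rw [act_consNat_mul, hx, zero_comp]

theorem isZero_HO_of_hyperIdeal_eq_top (h : hyperIdeal A = ⊤) (n : ℕ) : IsZero (HO k A n) := by
  let P := projectiveResolution (constRight.{u, v} k DeltaH)
  refine IsZero.of_iso ?_ (P.isoLeftDerivedObj (tensorFunctor k (barConstruction k A)) n)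
  refine (IsZero.iff_id_eq_zero _).2 ?_
  refine (act_consNat_one P n).symm.trans (act_consNat_eq_zero P n (a := (1 : A)) ?_)
  rw [h]
  exact TwoSidedIdeal.mem_top A

end Vanishing

/-! ### Tensor-hom adjunction for modules over a category -/

section RightExact

open CategoryTheory Limits TensorProduct

variable {k : Type u} [CommRing k] {C : Type} [SmallCategory C]

/-- The right module `c ↦ Hom_k(F c, M)`. -/
def homRight (F : C ⥤ ModuleCat.{w} k) (M : ModuleCat.{w} k) : Cᵒᵖ ⥤ ModuleCat.{w} k where
  obj c := ModuleCat.of k (F.obj c.unop →ₗ[k] M)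
  map α := ModuleCat.ofHom (LinearMap.lcomp k M (F.map α.unop).hom)

/-- Linear maps out of `G ⊗_C F` from families of linear maps compatible with the morphisms
of `C`. -/
def tensorLift {G : Cᵒᵖ ⥤ ModuleCat.{w} k} {F : C ⥤ ModuleCat.{w} k} {M : Type*} [AddCommGroup M]
    [Module k M] (f : ∀ c : C, G.obj (Opposite.op c) →ₗ[k] F.obj c →ₗ[k] M)
    (hf : ∀ (c d : C) (α : c ⟶ d) (x : G.obj (Opposite.op d)) (y : F.obj c),
      f c ((G.map α.op).hom x) y = f d x ((F.map α).hom y)) : TensorObj G F →ₗ[k] M :=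
  open Classical in
  Submodule.liftQ _ (DirectSum.toModule k C _ fun c => TensorProduct.lift (f c)) <| by
    rw [tensorRel, Submodule.span_le]
    rintro _ ⟨c, d, α, x, y, rfl⟩
    rw [SetLike.mem_coe, LinearMap.mem_ker, map_sub, sub_eq_zero, DirectSum.toModule_lof,
      DirectSum.toModule_lof]
    exact hf c d α x y

/-- The bilinear map `(x, y) ↦ [x ⊗ y]_c`. -/
def tensorMk (G : Cᵒᵖ ⥤ ModuleCat.{w} k) (F : C ⥤ ModuleCat.{w} k) (c : C) :
    G.obj (Opposite.op c) →ₗ[k] F.obj c →ₗ[k] TensorObj G F :=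
  open Classical in
  (TensorProduct.mk k _ _).compr₂ ((tensorRel G F).mkQ ∘ₗ
    DirectSum.lof k C (fun c => G.obj (Opposite.op c) ⊗[k] F.obj c) c)

theorem tensorMk_map (G : Cᵒᵖ ⥤ ModuleCat.{w} k) (F : C ⥤ ModuleCat.{w} k) {c d : C} (α : c ⟶ d)
    (x : G.obj (Opposite.op d)) (y : F.obj c) :
    tensorMk G F c ((G.map α.op).hom x) y = tensorMk G F d x ((F.map α).hom y) := by
  classical
  exact mk_map_tmul G α x y

theorem tensorMap_tensorMk {G G' : Cᵒᵖ ⥤ ModuleCat.{w} k} (Θ : G ⟶ G') (F : C ⥤ ModuleCat.{w} k)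
    (c : C) (x : G.obj (Opposite.op c)) (y : F.obj c) :
    tensorMap Θ F (tensorMk G F c x y) =
      tensorMk G' F c ((Θ.app (Opposite.op c)).hom x) y := by
  classical
  exact tensorMap_mk Θ F c x y

theorem tensorObj_ext {G : Cᵒᵖ ⥤ ModuleCat.{w} k} {F : C ⥤ ModuleCat.{w} k} {M : Type*}
    [AddCommGroup M] [Module k M] {f g : TensorObj G F →ₗ[k] M}
    (h : ∀ (c : C) (x : G.obj (Opposite.op c)) (y : F.obj c),
      f (tensorMk G F c x y) = g (tensorMk G F c x y)) : f = g := by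
  let _ : DecidableEq C := Classical.decEq C
  exact tensorObj_hom_ext h

theorem tensorLift_tensorMk {G : Cᵒᵖ ⥤ ModuleCat.{w} k} {F : C ⥤ ModuleCat.{w} k}
    {M : Type*} [AddCommGroup M] [Module k M]
    (f : ∀ c : C, G.obj (Opposite.op c) →ₗ[k] F.obj c →ₗ[k] M)
    (hf : ∀ (c d : C) (α : c ⟶ d) (x : G.obj (Opposite.op d)) (y : F.obj c),
      f c ((G.map α.op).hom x) y = f d x ((F.map α).hom y))
    (c : C) (x : G.obj (Opposite.op c)) (y : F.obj c) :
    tensorLift f hf (tensorMk G F c x y) = f c x y := by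
  refine (Submodule.liftQ_apply _ _ _).trans ?_
  rw [DirectSum.toModule_lof]
  rfl

/-- The map `G ⟶ Hom_k(F, M)` adjoint to a map `G ⊗_C F ⟶ M`. -/
def tensorCurry {F : C ⥤ ModuleCat.{w} k} {G : Cᵒᵖ ⥤ ModuleCat.{w} k} {M : ModuleCat.{w} k}
    (f : TensorObj G F →ₗ[k] M) : G ⟶ homRight F M where
  app c := ModuleCat.ofHom ((tensorMk G F c.unop).compr₂ f)
  naturality c d α := by
    apply ModuleCat.hom_ext
    refine LinearMap.ext fun x => LinearMap.ext fun y => ?_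
    exact congrArg f (tensorMk_map G F α.unop x y)

/-- The bilinear maps given by a map `G ⟶ Hom_k(F, M)`. -/
def homRightBilin {F : C ⥤ ModuleCat.{w} k} {G : Cᵒᵖ ⥤ ModuleCat.{w} k} {M : ModuleCat.{w} k}
    (g : G ⟶ homRight F M) (c : C) : G.obj (Opposite.op c) →ₗ[k] F.obj c →ₗ[k] M :=
  (g.app (Opposite.op c)).hom

/-- The map `G ⊗_C F ⟶ M` adjoint to a map `G ⟶ Hom_k(F, M)`. -/
def tensorUncurry {F : C ⥤ ModuleCat.{w} k} {G : Cᵒᵖ ⥤ ModuleCat.{w} k} {M : ModuleCat.{w} k}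
    (g : G ⟶ homRight F M) : TensorObj G F →ₗ[k] M :=
  tensorLift (homRightBilin g) fun _ _ α x y =>
    LinearMap.congr_fun (LinearMap.congr_fun (congrArg ModuleCat.Hom.hom (g.naturality α.op)) x) y

theorem tensorUncurry_tensorMk {F : C ⥤ ModuleCat.{w} k} {G : Cᵒᵖ ⥤ ModuleCat.{w} k}
    {M : ModuleCat.{w} k} (g : G ⟶ homRight F M) (c : C) (x : G.obj (Opposite.op c))
    (y : F.obj c) : tensorUncurry g (tensorMk G F c x y) = homRightBilin g c x y :=
  tensorLift_tensorMk _ _ c x y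

/-- Maps `G ⊗_C F ⟶ M` are maps `G ⟶ Hom_k(F, M)`. -/
def tensorHomEquiv (F : C ⥤ ModuleCat.{w} k) (G : Cᵒᵖ ⥤ ModuleCat.{w} k) (M : ModuleCat.{w} k) :
    ((tensorFunctor k F).obj G ⟶ M) ≃ (G ⟶ homRight F M) where
  toFun f := tensorCurry f.hom
  invFun g := ModuleCat.ofHom (tensorUncurry g)
  left_inv f := by
    apply ModuleCat.hom_ext
    exact tensorObj_ext fun c x y => tensorUncurry_tensorMk (tensorCurry f.hom) c x y
  right_inv g := by
    ext c : 2
    apply ModuleCat.hom_ext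
    refine LinearMap.ext fun x => LinearMap.ext fun y => ?_
    exact tensorUncurry_tensorMk g c.unop x y

/-- The right adjoint is `M ↦ Hom_k(F, M)`. The resulting right exactness identifies the zeroth left
derived functor with the functor itself. -/
instance (F : C ⥤ ModuleCat.{w} k) : (tensorFunctor k F).IsLeftAdjoint :=
  (Adjunction.adjunctionOfEquivRight (F := tensorFunctor k F) (tensorHomEquiv F)
    fun G' G M f g => by
      ext c : 2
      apply ModuleCat.hom_ext
      refine LinearMap.ext fun x => LinearMap.ext fun y => ?_
      exact congrArg g.hom (tensorMap_tensorMk f F c.unop x y)).isLeftAdjoint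

end RightExact

/-! ### Computation of `HO_0` for commutative algebras -/

section DegreeZero

open CategoryTheory TensorProduct

variable (k : Type u) [CommRing k] [StarRing k] [TrivialStar k]

/-- `HO_0(A)` is the tensor product `k^⋆ ⊗ H_A`. -/
def HOZeroEquiv (A : Type v) [Ring A] [StarRing A] [Algebra k A] [StarModule k A] :
    HO k A 0 ≃ₗ[k] TensorObj (constRight.{u, v} k DeltaH) (barConstruction k A) :=
  ((tensorFunctor k (barConstruction k A)).leftDerivedZeroIsoSelf.app
    (constRight.{u, v} k DeltaH)).toLinearEquiv

section

variable {A : Type v} [CommRing A] [StarRing A] [Algebra k A] [StarModule k A]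
  {B : Type v} [CommRing B] [Algebra k B]

omit [StarModule k A] [StarRing k] [TrivialStar k] in
variable {k} in
-- The labels are invisible to `q`, and the concatenated words list each index exactly once, in an
-- order that commutativity of `B` ignores.
theorem map_prod_wordProd (q : A →ₐ[k] B) (hq : ∀ a, q (star a) = q a) {n m : ℕ} (f : DHom n m)
    (x : Fin (n + 1) → A) : ∏ j, q (wordProd x (f.word j)) = ∏ i, q (x i) := by
  have h (L : List (Bool × Fin (n + 1))) :
      q (wordProd x L) = (L.map fun y => q (x y.2)).prod := by
    rw [wordProd, map_list_prod, List.map_map]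
    refine congrArg List.prod (List.map_congr_left ?_)
    rintro ⟨b, i⟩ -
    cases b <;> simp [conj, hq]
  have h' (L : List (Fin (m + 1))) : (L.map fun j => q (wordProd x (f.word j))).prod =
      ((L.flatMap f.word).map fun y => q (x y.2)).prod := by
    induction L with
    | nil => rfl
    | cons j L ih => rw [List.map_cons, List.prod_cons, ih, h, List.flatMap_cons, List.map_append,
        List.prod_append]
  rw [Fin.prod_univ_def, h', DHom.flatMap_word, List.map_map,
    ← Equiv.prod_comp f.σ.symm fun i => q (x i), Fin.prod_univ_def]
  rfl

/-- The map `a_0 ⊗ ⋯ ⊗ a_n ↦ q(a_0) ⋯ q(a_n)`. -/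
def tensorPowerProd (q : A →ₐ[k] B) (n : ℕ) : (⨂[k] _ : Fin (n + 1), A) →ₗ[k] B :=
  PiTensorProduct.lift
    ((MultilinearMap.mkPiAlgebra k (Fin (n + 1)) B).compLinearMap fun _ => q.toLinearMap)

omit [StarRing k] [TrivialStar k] [StarRing A] [StarModule k A] in
theorem tensorPowerProd_tprod (q : A →ₐ[k] B) (n : ℕ) (x : Fin (n + 1) → A) :
    tensorPowerProd k q n (PiTensorProduct.tprod k x) = ∏ i, q (x i) := by
  simp [tensorPowerProd]

theorem tensorPowerProd_barMap (q : A →ₐ[k] B) (hq : ∀ a, q (star a) = q a) {n m : ℕ}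
    (f : DHom n m) (x : ⨂[k] _ : Fin (n + 1), A) :
    tensorPowerProd k q m (barMap k A f x) = tensorPowerProd k q n x := by
  suffices h : tensorPowerProd k q m ∘ₗ barMap k A f = tensorPowerProd k q n from
    LinearMap.congr_fun h x
  ext x
  change tensorPowerProd k q m (barMap k A f (PiTensorProduct.tprod k x)) =
    tensorPowerProd k q n (PiTensorProduct.tprod k x)
  rw [barMap_tprod, tensorPowerProd_tprod, tensorPowerProd_tprod, map_prod_wordProd q hq]

/-- The maps `k ⊗ A^{⊗ (n + 1)} ⟶ B`, `r ⊗ (a_0 ⊗ ⋯ ⊗ a_n) ↦ r q(a_0) ⋯ q(a_n)`. -/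
def smulTensorPowerProd (q : A →ₐ[k] B) (c : DeltaH) :
    (constRight.{u, v} k DeltaH).obj (Opposite.op c) →ₗ[k] (barConstruction k A).obj c →ₗ[k] B :=
  LinearMap.toSpanSingleton k _ (tensorPowerProd k q c.deg) ∘ₗ
    (ULift.moduleEquiv (R := k) (M := k)).toLinearMap

/-- The map `k^⋆ ⊗ H_A ⟶ B`, `[r ⊗ (a_0 ⊗ ⋯ ⊗ a_n)] ↦ r q(a_0) ⋯ q(a_n)`. -/
def tensorObjToAlgebra (q : A →ₐ[k] B) (hq : ∀ a, q (star a) = q a) :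
    TensorObj (constRight.{u, v} k DeltaH) (barConstruction k A) →ₗ[k] B :=
  tensorLift (smulTensorPowerProd k q) fun _ _ α x y =>
    congrArg ((ULift.down x : k) • ·) (tensorPowerProd_barMap k q hq α y).symm

variable (A) in
/-- The map `A^{⊗ (n + 1)} ⟶ k^⋆ ⊗ H_A`, `x ↦ [1 ⊗ x]`. -/
def ofTensorPower (n : ℕ) : (⨂[k] _ : Fin (n + 1), A) →ₗ[k]
    TensorObj (constRight.{u, v} k DeltaH) (barConstruction k A) :=
  tensorMk (constRight.{u, v} k DeltaH) (barConstruction k A) ⟨n⟩ (ULift.up 1)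

theorem ofTensorPower_barMap {n m : ℕ} (f : DHom n m) (x : ⨂[k] _ : Fin (n + 1), A) :
    ofTensorPower k A m (barMap k A f x) = ofTensorPower k A n x :=
  (tensorMk_map (constRight.{u, v} k DeltaH) (barConstruction k A)
    (c := ⟨n⟩) (d := ⟨m⟩) f (ULift.up 1) x).symm

theorem tensorObjToAlgebra_ofTensorPower (q : A →ₐ[k] B) (hq : ∀ a, q (star a) = q a) (n : ℕ)
    (x : ⨂[k] _ : Fin (n + 1), A) :
    tensorObjToAlgebra k q hq (ofTensorPower k A n x) = tensorPowerProd k q n x :=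
  (tensorLift_tensorMk (smulTensorPowerProd k q) _ ⟨n⟩ (ULift.up 1) x).trans (one_smul k _)

theorem tensorMk_eq_ofTensorPower (c : DeltaH) (r : ULift.{v} k)
    (x : ⨂[k] _ : Fin (c.deg + 1), A) :
    tensorMk (constRight.{u, v} k DeltaH) (barConstruction k A) c r x =
      ofTensorPower k A c.deg (r.down • x) := by
  have h : r = r.down • (ULift.up 1 : ULift.{v} k) := ULift.ext _ _ (mul_one r.down).symm
  rw [map_smul]
  refine (congrArg (fun r => tensorMk (constRight.{u, v} k DeltaH) (barConstruction k A) c r x)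
    h).trans ?_
  exact LinearMap.map_smul₂ (tensorMk (constRight.{u, v} k DeltaH) (barConstruction k A) c)
    r.down (ULift.up 1) x

/-- The morphism `[n] ⟶ [0]` multiplying in the standard order. -/
def DHom.toZero (n : ℕ) (z : Fin (n + 1) → Bool) : DHom n 0 :=
  ⟨⟨fun _ => 0, fun _ _ _ => le_rfl⟩, z, Equiv.refl _⟩

theorem DHom.word_toZero (n : ℕ) (z : Fin (n + 1) → Bool) (j : Fin 1) :
    (DHom.toZero n z).word j = (List.finRange (n + 1)).map fun i => (z i, i) := by
  have : j = 0 := Subsingleton.elim _ _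
  subst this
  have := DHom.flatMap_word (DHom.toZero n z)
  simpa [List.finRange_succ, DHom.toZero] using this

variable (A) in
/-- The map `A ⟶ k^⋆ ⊗ H_A`, `a ↦ [1 ⊗ a]`. -/
def ofAlgebra : A →ₗ[k] TensorObj (constRight.{u, v} k DeltaH) (barConstruction k A) :=
  ofTensorPower k A 0 ∘ₗ (PiTensorProduct.subsingletonEquiv (R := k) (s := fun _ => A)
    (0 : Fin 1)).symm.toLinearMap

/-- The morphism `[n] ⟶ [0]` multiplying all factors carries any generator to one in degree zero
without changing its class. -/
theorem ofAlgebra_surjective : Function.Surjective (ofAlgebra k A) := by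
  -- Surjectivity is restated as the vanishing of the projection modulo the range, a linear map that
  -- can be tested on generators.
  rw [← LinearMap.range_eq_top, ← Submodule.ker_mkQ (LinearMap.range (ofAlgebra k A)),
    LinearMap.ker_eq_top]
  refine tensorObj_ext fun c r x => ?_
  rw [LinearMap.zero_apply, Submodule.mkQ_apply, Submodule.Quotient.mk_eq_zero]
  refine (congrArg (· ∈ LinearMap.range (ofAlgebra k A))
    (tensorMk_eq_ofTensorPower k c r x)).mpr ?_
  rw [← ofTensorPower_barMap k (DHom.toZero c.deg fun _ => false)]
  exact ⟨(PiTensorProduct.subsingletonEquiv (R := k) (s := fun _ => A) (0 : Fin 1))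
    (barMap k A (DHom.toZero c.deg fun _ => false) ((r : ULift.{v} k).down • x)),
      congrArg (ofTensorPower k A 0) (LinearEquiv.symm_apply_apply _ _)⟩

theorem tensorObjToAlgebra_ofAlgebra (q : A →ₐ[k] B) (hq : ∀ a, q (star a) = q a) (a : A) :
    tensorObjToAlgebra k q hq (ofAlgebra k A a) = q a := by
  refine (tensorObjToAlgebra_ofTensorPower k q hq 0 _).trans ?_
  have h : (PiTensorProduct.subsingletonEquiv (R := k) (s := fun _ => A) (0 : Fin 1)).symm a =
      PiTensorProduct.tprod k fun _ => a := by
    rw [LinearEquiv.symm_apply_eq]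
    simp
  refine (congrArg (tensorPowerProd k q 0) h).trans ?_
  simp [tensorPowerProd_tprod]

/-- The labelling `z` is arbitrary while the left side does not involve it; comparing two labellings
produces the relations on `A`. -/
theorem ofTensorPower_tprod {n : ℕ} (x : Fin (n + 1) → A) (z : Fin (n + 1) → Bool) :
    ofTensorPower k A n (PiTensorProduct.tprod k x) = ofAlgebra k A (∏ i, conj (z i) (x i)) := by
  rw [← ofTensorPower_barMap k (DHom.toZero n z), ofAlgebra]
  refine congrArg (ofTensorPower k A 0) ?_
  refine (LinearEquiv.eq_symm_apply _).2 ?_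
  simp [barMap_tprod, DHom.word_toZero, wordProd, Fin.prod_univ_def, Function.comp_def]

theorem ofAlgebra_mul_star (a b : A) : ofAlgebra k A (a * star b) = ofAlgebra k A (a * b) := by
  have h₁ := ofTensorPower_tprod k ![a, b] ![false, false]
  have h₂ := ofTensorPower_tprod k ![a, b] ![false, true]
  simpa [conj] using h₂.symm.trans h₁

theorem ofAlgebra_eq_zero {a : A}
    (ha : a ∈ TwoSidedIdeal.span {x : A | ∃ a : A, x = a - star a}) : ofAlgebra k A a = 0 := by
  -- `ofAlgebra` is only linear, so induction over the ideal needs the multiplier `b` to absorb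
  -- multiplications.
  suffices h : ∀ b, ofAlgebra k A (b * a) = 0 by simpa using h 1
  induction ha using TwoSidedIdeal.span_induction with
  | mem x h =>
    obtain ⟨a, rfl⟩ := h
    intro b
    rw [mul_sub, map_sub, ofAlgebra_mul_star, sub_self]
  | zero => simp
  | add x y _ _ hx hy => simp [mul_add, hx, hy]
  | neg x _ hx => simp [hx]
  | left_absorb a x _ hx => exact fun b => by rw [← mul_assoc, hx]
  | right_absorb a x _ hx => exact fun b => by rw [mul_comm x, ← mul_assoc, hx]

/-- `k^⋆ ⊗ H_A` is the coinvariants of `A`. -/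
def tensorObjEquiv (q : A →ₐ[k] B) (hq : Function.Surjective q)
    (hq' : ∀ a, q a = 0 ↔ a ∈ TwoSidedIdeal.span {x : A | ∃ a : A, x = a - star a}) :
    TensorObj (constRight.{u, v} k DeltaH) (barConstruction k A) ≃ₗ[k] B :=
  have hs (a) : q (star a) = q a := by
    rw [eq_comm, ← sub_eq_zero, ← map_sub, hq']
    exact TwoSidedIdeal.subset_span ⟨a, rfl⟩
  LinearEquiv.ofBijective (tensorObjToAlgebra k q hs) <| by
    constructor
    · rw [← LinearMap.ker_eq_bot, LinearMap.ker_eq_bot']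
      intro t ht
      obtain ⟨a, rfl⟩ := ofAlgebra_surjective k t
      rw [tensorObjToAlgebra_ofAlgebra, hq'] at ht
      exact ofAlgebra_eq_zero k ht
    · intro b
      obtain ⟨a, rfl⟩ := hq b
      exact ⟨ofAlgebra k A a, tensorObjToAlgebra_ofAlgebra k q hs a⟩

theorem nonempty_HO_zero_equiv (hs : ∀ a : A, star a = a) : Nonempty (HO k A 0 ≃ₗ[k] A) :=
  ⟨HOZeroEquiv k A ≪≫ₗ tensorObjEquiv k (AlgHom.id k A) Function.surjective_id fun a => by
    have : {x : A | ∃ a : A, x = a - star a} = {0} := by ext; simp [hs]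
    rw [this]
    refine ⟨fun h => ?_, fun h => ?_⟩
    · rw [show a = 0 from h]
      exact TwoSidedIdeal.zero_mem _
    · exact TwoSidedIdeal.mem_bot _ |>.1
        (TwoSidedIdeal.span_le (I := ⊥) |>.2 (by simp) h)⟩

variable (A) in
theorem nonempty_HO_zero_equiv_coinvariants : Nonempty (HO k A 0 ≃ₗ[k] Coinvariants A) :=
  ⟨HOZeroEquiv k A ≪≫ₗ tensorObjEquiv k
    (RingCon.mkₐ k (TwoSidedIdeal.span {x : A | ∃ a : A, x = a - star a}).ringCon)
    (RingCon.mkₐ_surjective _) fun a => by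
      rw [TwoSidedIdeal.mem_iff, ← RingCon.eq]
      rfl⟩

end

end DegreeZero

end HyperHom

end

theorem mainTheorem5 {k : Type u} [CommRing k] [StarRing k] [TrivialStar k]
    {A : Type v} [Ring A] [StarRing A] [Algebra k A] [StarModule k A] :
    ((∀ a b : A, a * b = b * a) → (∀ a : A, star a = a) →
      Nonempty (HyperHom.HO k A 0 ≃ₗ[k] A)) ∧
    ((∀ a b : A, a * b = b * a) → (∃ a : A, star a ≠ a) →
      Nonempty (HyperHom.HO k A 0 ≃ₗ[k] HyperHom.Coinvariants A)) ∧
    (HyperHom.hyperIdeal A = ⊤ →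
      ∀ n : ℕ, CategoryTheory.Limits.IsZero (HyperHom.HO k A n)) := by
  refine ⟨fun hc hs => ?_, fun hc _ => ?_, HyperHom.isZero_HO_of_hyperIdeal_eq_top⟩
  -- The commutative structure extends the given ring structure, so the homology it defines is the
  -- same module.
  · let _ : CommRing A := { ‹Ring A› with mul_comm := hc }
    exact HyperHom.nonempty_HO_zero_equiv k hs
  · let _ : CommRing A := { ‹Ring A› with mul_comm := hc }
    exact HyperHom.nonempty_HO_zero_equiv_coinvariants k A
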